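/- **Setting.** Let $P_{Y_1Y_2|X}$ be a two-receiver discrete memoryless broadcast channel with finite alphabets. For a distribution $P_{UVX}$ with finite alphabets $\mathcal U,\mathcal V$, and $(U,V)-X-(Y_1,Y_2)$ Markov, Marton's region is the set of pairs $R_1,R_2\ge 0$ with $R_1\le I(U;Y_1)$, $R_2\le I(V;Y_2)$, $R_1+R_2\le I(U;Y_1)+I(V;Y_2)-I(U;V)$ (information in bits). **Scheme.** Fix $P_{UV}$, a function $g:\mathcal U\times\mathcal V\to\mathcal X$, $\alpha\in[0,1]$, rates $R_1,R_2$, bin rates $R_1',R_2'$ and tolerances $0<\epsilon'<\epsilon$. For block length $n$ let $n_1=\lfloor\alpha n\rfloor$, $n_2=n-n_1$. A string $s^m$ is $\epsilon$-typical for $P$ if $|N(a|s^m)-mP(a)|\le\epsilon mP(a)$ for all letters $a$, where $N(a|s^m)$ counts the occurrences of $a$. Message $m_k$ of a block takes $\lceil 2^{nR_k}\rceil$ values and the bin index $l_k$ takes $\lceil 2^{n_kR_k'}\rceil$ values. The words $u^{n_1}(m_1,l_1)$, $u^{n_2}(m_1)$ have letters i.i.d. $P_U$, the words $v^{n_2}(m_2,l_2)$,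 $v^{n_1}(m_2)$ have letters i.i.d. $P_V$, all independent. A block of receiver 1 is $[u^{n_1}(m_1,l_1),u^{n_2}(m_1)]$, a block of receiver 2 is $[v^{n_2}(m_2,l_2),v^{n_1}(m_2)]$; the blocks of receiver 2 are delayed by $n_1$ symbols, and the channel input is $x_t=g(u_t,v_t)$. Encoder 1 chooses $l_1$ such that $u^{n_1}(m_1,l_1)$ is jointly $\epsilon'$-typical for $P_{UV}$ with the overlapping word $v^{n_1}$ of the previous message of receiver 2. Encoder 2 chooses $l_2$ such that $v^{n_2}(m_2,l_2)$ is jointly $\epsilon'$-typical with the overlapping word $u^{n_2}$ of the current message of receiver 1. If no such index exists, a fixed one is taken. Receiver 1 looks for $(\hat m_1,\hat l_1)$ such that $u^{n_1}(\hat m_1,\hat l_1)$ and $u^{n_2}(\hat m_1)$ are each jointly $\epsilon$-typical for $P_{UY_1}$ with the corresponding outputs; receiver 2 proceeds analogously. With $B$ blocks per receiver, and a fixed known message at the two ends where only one of the users has a block, this is a code of length $Bn+n_1$. The same parameters and codebooks are used for all blocks. **Theorem 1.** 1. For all $P_{UV}$, $g$, $\alpha\in[0,1]$, and all $$R_1<I(U;Y_1)-\alpha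 I(U;V),\qquad R_2<I(V;Y_2)-(1-\alpha)I(U;V),$$ there are bin rates $R_1',R_2'>I(U;V)$ and $\epsilon_0>0$ such that for all $0<\epsilon'<\epsilon<\epsilon_0$ and every number $B$ of blocks, the probability that some message of some receiver is decoded wrongly, averaged over the random codebooks, tends to $0$ as $n\to\infty$, uniformly in the transmitted messages. 2. For all $P_{UV}$ and $g$, as $\alpha$ ranges over $[0,1]$, the pairs $\big(I(U;Y_1)-\alpha I(U;V),\ I(V;Y_2)-(1-\alpha)I(U;V)\big)$ sweep exactly the dominant face $\{R_1\le I(U;Y_1),\ R_2\le I(V;Y_2),\ R_1+R_2=I(U;Y_1)+I(V;Y_2)-I(U;V)\}$, which is the segment between the corner points $(I(U;Y_1),I(V;Y_2)-I(U;V))$ and $(I(U;Y_1)-I(U;V),I(V;Y_2))$. 3. For all $P_{UV}$ and $g$, the scheme achieves every pair $(R_1,R_2)$ in Marton's region of $P_{UV}$ and $X=g(U,V)$, without time-sharing or rate-splitting: there is a single $\alpha\in[0,1]$ such that for every $\delta>0$ there are parameters of the scheme with this $\alpha$ for which, for all sufficiently large $B$ and every $\eta>0$, for all sufficiently large $n$,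 some realization of the codebooks gives a code whose overall rates (all message bits over all $Bn+n_1$ channel uses) are at least $R_1-\delta$ and $R_2-\delta$ and whose error probability for uniform messages is at most $\eta$. Moreover, every pair in Marton's region of an arbitrary $P_{UVX}$ is achieved in this sense by the scheme for some finite alphabets $\mathcal U',\mathcal V'$, some $P_{U'V'}$ and some $g:\mathcal U'\times\mathcal V'\to\mathcal X$. -/

import Mathlib

open scoped BigOperators

noncomputable section

namespace TSA

open Classical in
/-- The number `N(a | s)` of occurrences of the letter `a` in the string `s`. -/
def count {A : Type*} {n : ℕ} (a : A) (s : Fin n → A) : ℕ :=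
  (Finset.univ.filter (fun i => s i = a)).card

/-- `ε`-typicality `|N(a|s)/n - p a| ≤ ε p a` for all letters `a`, multiplied by `n`
(so that the empty string is typical). -/
def Typical {A : Type*} {n : ℕ} (p : A → ℝ) (ε : ℝ) (s : Fin n → A) : Prop :=
  ∀ a, |(count a s : ℝ) - n * p a| ≤ ε * (n * p a)

section Information

variable {A B : Type*} [Fintype A] [Fintype B]

/-- First marginal of a joint distribution. -/
def fstMarginal (p : A × B → ℝ) (a : A) : ℝ := ∑ b, p (a, b)

/-- Second marginal of a joint distribution. -/
def sndMarginal (p : A × B → ℝ) (b : B) : ℝ := ∑ a, p (a, b)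

/-- Mutual information in bits of a pair with joint distribution `p`;
letters of probability zero contribute zero. -/
def mutualInfo (p : A × B → ℝ) : ℝ :=
  ∑ a, ∑ b, p (a, b) * Real.logb 2 (p (a, b) / (fstMarginal p a * sndMarginal p b))

end Information

section Channel

variable {X Y₁ Y₂ U V : Type*} [Fintype X] [Fintype Y₁] [Fintype Y₂] [Fintype U] [Fintype V]

/-- The joint distribution of `(U, V)` when `(U, V, X)` has distribution `Q`. -/
def jointUV (Q : U × V × X → ℝ) (p : U × V) : ℝ := ∑ x, Q (p.1, p.2, x)

/-- The joint distribution of `(U, Y₁)` when `(U, V, X)` has distribution `Q` and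
`(Y₁, Y₂)` is the output of the channel `W` on input `X`. -/
def jointUY₁ (W : X → Y₁ × Y₂ → ℝ) (Q : U × V × X → ℝ) (p : U × Y₁) : ℝ :=
  ∑ v, ∑ x, ∑ y₂, Q (p.1, v, x) * W x (p.2, y₂)

/-- The joint distribution of `(V, Y₂)` when `(U, V, X)` has distribution `Q` and
`(Y₁, Y₂)` is the output of the channel `W` on input `X`. -/
def jointVY₂ (W : X → Y₁ × Y₂ → ℝ) (Q : U × V × X → ℝ) (p : V × Y₂) : ℝ :=
  ∑ u, ∑ x, ∑ y₁, Q (u, p.1, x) * W x (y₁, p.2)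

open Classical in
/-- The distribution of `(U, V, X)` when `(U, V)` has distribution `P` and `X = g(U, V)`. -/
def withInput (P : U × V → ℝ) (g : U → V → X) (q : U × V × X) : ℝ :=
  if q.2.2 = g q.1 q.2.1 then P (q.1, q.2.1) else 0

/-- Marton's region of rate pairs of the channel `W` for a fixed distribution `Q` of
`(U, V, X)`, where `(U, V) - X - (Y₁, Y₂)` is a Markov chain. -/
def martonRegion (W : X → Y₁ × Y₂ → ℝ) (Q : U × V × X → ℝ) : Set (ℝ × ℝ) :=
  {R | 0 ≤ R.1 ∧ 0 ≤ R.2 ∧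
    R.1 ≤ mutualInfo (jointUY₁ W Q) ∧ R.2 ≤ mutualInfo (jointVY₂ W Q) ∧
    R.1 + R.2 ≤ mutualInfo (jointUY₁ W Q) + mutualInfo (jointVY₂ W Q)
      - mutualInfo (jointUV Q)}

end Channel

/-- A length-`N` code for a two-receiver broadcast channel with message sets `S₁`, `S₂`. -/
structure BCCode (X Y₁ Y₂ S₁ S₂ : Type*) (N : ℕ) where
  enc : S₁ → S₂ → Fin N → X
  dec₁ : (Fin N → Y₁) → S₁
  dec₂ : (Fin N → Y₂) → S₂

namespace BCCode

variable {X Y₁ Y₂ S₁ S₂ : Type*} [Fintype Y₁] [Fintype Y₂] {N : ℕ}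

open Classical in
/-- Probability over the memoryless channel `W` that at least one receiver decodes wrongly
when the messages `s₁`, `s₂` are sent. -/
def errProb (c : BCCode X Y₁ Y₂ S₁ S₂ N) (W : X → Y₁ × Y₂ → ℝ) (s₁ : S₁) (s₂ : S₂) : ℝ :=
  ∑ y₁ : Fin N → Y₁, ∑ y₂ : Fin N → Y₂,
    if c.dec₁ y₁ = s₁ ∧ c.dec₂ y₂ = s₂ then 0 else ∏ t, W (c.enc s₁ s₂ t) (y₁ t, y₂ t)

/-- Error probability for independent, uniformly distributed messages. -/
def avgErrProb [Fintype S₁] [Fintype S₂] (c : BCCode X Y₁ Y₂ S₁ S₂ N)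
    (W : X → Y₁ × Y₂ → ℝ) : ℝ :=
  (∑ s₁, ∑ s₂, c.errProb W s₁ s₂) / (Fintype.card S₁ * Fintype.card S₂)

end BCCode

/-- A pair of codebooks for time-shifted alternating Gelfand-Pinsker coding. For each receiver
there is a Gelfand-Pinsker part, with several words per message (a bin), and a direct part, with
one word per message. A block of receiver 1 is a Gelfand-Pinsker part of length `n₁` followed by
a direct part of length `n₂`; a block of receiver 2 is a Gelfand-Pinsker part of length `n₂`
followed by a direct part of length `n₁`. -/
structure Codebook (U V : Type*) (n₁ n₂ M₁ M₂ L₁ L₂ : ℕ) where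
  uGP : Fin M₁ → Fin L₁ → Fin n₁ → U
  uDir : Fin M₁ → Fin n₂ → U
  vGP : Fin M₂ → Fin L₂ → Fin n₂ → V
  vDir : Fin M₂ → Fin n₁ → V

namespace Codebook

variable {X Y₁ Y₂ U V : Type*} {n₁ n₂ M₁ M₂ L₁ L₂ : ℕ}

/-- Expectation of `f` over the random codebooks all of whose letters are independent, with
distribution `pU` for receiver 1 and `pV` for receiver 2. -/
def expect [Fintype U] [Fintype V] (pU : U → ℝ) (pV : V → ℝ)
    (f : Codebook U V n₁ n₂ M₁ M₂ L₁ L₂ → ℝ) : ℝ :=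
  ∑ a : Fin M₁ → Fin L₁ → Fin n₁ → U, ∑ b : Fin M₁ → Fin n₂ → U,
    ∑ c : Fin M₂ → Fin L₂ → Fin n₂ → V, ∑ d : Fin M₂ → Fin n₁ → V,
      (∏ m, ∏ l, ∏ i, pU (a m l i)) * (∏ m, ∏ i, pU (b m i)) *
      (∏ m, ∏ l, ∏ i, pV (c m l i)) * (∏ m, ∏ i, pV (d m i)) * f ⟨a, b, c, d⟩

variable (C : Codebook U V n₁ n₂ M₁ M₂ L₁ L₂)

open Classical in
/-- Binning at encoder 1: given the previous message `m₂` of receiver 2, choose an index such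
that the two overlapping words are jointly typical; index `0` if there is none. -/
def bin₁ [NeZero L₁] (P : U × V → ℝ) (ε : ℝ) (m₁ : Fin M₁) (m₂ : Fin M₂) : Fin L₁ :=
  if h : ∃ l, Typical P ε (fun i => (C.uGP m₁ l i, C.vDir m₂ i)) then h.choose else 0

open Classical in
/-- Binning at encoder 2: given the previous message `m₁` of receiver 1, choose an index such
that the two overlapping words are jointly typical; index `0` if there is none. -/
def bin₂ [NeZero L₂] (P : U × V → ℝ) (ε : ℝ) (m₁ : Fin M₁) (m₂ : Fin M₂) : Fin L₂ :=
  if h : ∃ l, Typical P ε (fun i => (C.uDir m₁ i, C.vGP m₂ l i)) then h.choose else 0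

open Classical in
/-- Decoding of one block of receiver 1 from the outputs `y` and `y'` that belong to the
Gelfand-Pinsker part and to the direct part; message `0` if no candidate is found. -/
def decBlock₁ [NeZero M₁] (p : U × Y₁ → ℝ) (ε : ℝ) (y : Fin n₁ → Y₁) (y' : Fin n₂ → Y₁) :
    Fin M₁ :=
  if h : ∃ m, ∃ l, Typical p ε (fun i => (C.uGP m l i, y i)) ∧
    Typical p ε (fun i => (C.uDir m i, y' i)) then h.choose else 0

open Classical in
/-- Decoding of one block of receiver 2 from the outputs `y` and `y'` that belong to the
Gelfand-Pinsker part and to the direct part; message `0` if no candidate is found. -/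
def decBlock₂ [NeZero M₂] (p : V × Y₂ → ℝ) (ε : ℝ) (y : Fin n₂ → Y₂) (y' : Fin n₁ → Y₂) :
    Fin M₂ :=
  if h : ∃ m, ∃ l, Typical p ε (fun i => (C.vGP m l i, y i)) ∧
    Typical p ε (fun i => (C.vDir m i, y' i)) then h.choose else 0

end Codebook

section Stream

variable {M B : ℕ} [NeZero M]

/-- The message of block `b`; after the last block the fixed message `0` is used. -/
def msgAt (m : Fin B → Fin M) (b : ℕ) : Fin M :=
  if h : b < B then m ⟨b, h⟩ else 0

/-- The message of the block before block `b`; before the first block the fixed message `0`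
is used. -/
def msgBefore (m : Fin B → Fin M) : ℕ → Fin M
  | 0 => 0
  | b + 1 => msgAt m b

end Stream

theorem mod_sub_lt {B n₁ n₂ t : ℕ} (ht : t < B * (n₁ + n₂) + n₁)
    (h : ¬ t % (n₁ + n₂) < n₁) : t % (n₁ + n₂) - n₁ < n₂ := by
  rcases Nat.eq_zero_or_pos (n₁ + n₂) with h0 | h0
  · rw [h0] at ht
    omega
  · have := Nat.mod_lt t h0
    omega

theorem pos_lt {B b n r k : ℕ} (hb : b < B) (hr : r < n + k) : b * n + r < B * n + k := by
  have : (b + 1) * n ≤ B * n := Nat.mul_le_mul_right n hb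
  rw [Nat.add_mul] at this
  omega

section Code

variable {X Y₁ Y₂ U V : Type*} {n₁ n₂ M₁ M₂ L₁ L₂ : ℕ}
  [NeZero M₁] [NeZero M₂] [NeZero L₁] [NeZero L₂]

/-- The channel inputs for `B` blocks of messages. Time is cut into segments of lengths
`n₁, n₂, n₁, n₂, …, n₁`. Segment `2b` carries the Gelfand-Pinsker part of block `b` of receiver 1
on top of the direct part of block `b - 1` of receiver 2, and segment `2b + 1` carries the direct
part of block `b` of receiver 1 below the Gelfand-Pinsker part of block `b` of receiver 2. -/
def tsaEnc (P : U × V → ℝ) (g : U → V → X) (ε : ℝ) (B : ℕ)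
    (C : Codebook U V n₁ n₂ M₁ M₂ L₁ L₂) (m₁ : Fin B → Fin M₁) (m₂ : Fin B → Fin M₂)
    (t : Fin (B * (n₁ + n₂) + n₁)) : X :=
  let b := (t : ℕ) / (n₁ + n₂)
  if h : (t : ℕ) % (n₁ + n₂) < n₁ then
    g (C.uGP (msgAt m₁ b) (C.bin₁ P ε (msgAt m₁ b) (msgBefore m₂ b)) ⟨t % (n₁ + n₂), h⟩)
      (C.vDir (msgBefore m₂ b) ⟨t % (n₁ + n₂), h⟩)
  else
    g (C.uDir (msgAt m₁ b) ⟨t % (n₁ + n₂) - n₁, mod_sub_lt t.isLt h⟩)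
      (C.vGP (msgAt m₂ b) (C.bin₂ P ε (msgAt m₁ b) (msgAt m₂ b))
        ⟨t % (n₁ + n₂) - n₁, mod_sub_lt t.isLt h⟩)

/-- The time-shifted alternating Gelfand-Pinsker code for `B` blocks of each receiver. With
`n = n₁ + n₂`, block `b` of receiver 1 occupies the times from `b n` to `b n + n - 1`, and
block `b` of receiver 2 occupies the times from `n₁ + b n` to `n₁ + b n + n - 1`. -/
def tsaCode (P : U × V → ℝ) (g : U → V → X) (p₁ : U × Y₁ → ℝ) (p₂ : V × Y₂ → ℝ)
    (εEnc εDec : ℝ) (B : ℕ) (C : Codebook U V n₁ n₂ M₁ M₂ L₁ L₂) :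
    BCCode X Y₁ Y₂ (Fin B → Fin M₁) (Fin B → Fin M₂) (B * (n₁ + n₂) + n₁) where
  enc := tsaEnc P g εEnc B C
  dec₁ y b := C.decBlock₁ p₁ εDec
    (fun i => y ⟨b * (n₁ + n₂) + i, pos_lt b.isLt (by omega)⟩)
    (fun i => y ⟨b * (n₁ + n₂) + (n₁ + i), pos_lt b.isLt (by omega)⟩)
  dec₂ y b := C.decBlock₂ p₂ εDec
    (fun i => y ⟨b * (n₁ + n₂) + (n₁ + i), pos_lt b.isLt (by omega)⟩)
    (fun i => y ⟨b * (n₁ + n₂) + (n₁ + n₂ + i), pos_lt b.isLt (by omega)⟩)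

end Code

/-- The number `2^(n R)` of indices of rate `R` at length `n`, rounded up to an integer. -/
def numIdx (n : ℕ) (R : ℝ) : ℕ := ⌈(2 : ℝ) ^ ((n : ℝ) * R)⌉₊

instance (n : ℕ) (R : ℝ) : NeZero (numIdx n R) :=
  ⟨(Nat.ceil_pos.2 (Real.rpow_pos_of_pos two_pos _)).ne'⟩

/-- Parameters of the scheme: the relative offset `α` of the blocks of receiver 2, the message
rates per block, the rates of the bins, and the tolerances of the encoders and decoders. -/
structure Params where
  α : ℝ
  rate₁ : ℝ
  rate₂ : ℝ
  binRate₁ : ℝ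
  binRate₂ : ℝ
  εEnc : ℝ
  εDec : ℝ

namespace Params

variable (s : Params)

/-- The offset `n₁` for block length `n`. -/
def n₁ (n : ℕ) : ℕ := ⌊s.α * n⌋₊

/-- The remaining length `n₂ = n - n₁`. -/
def n₂ (n : ℕ) : ℕ := n - s.n₁ n

/-- Number of messages of receiver 1 per block. -/
abbrev M₁ (n : ℕ) : ℕ := numIdx n s.rate₁

/-- Number of messages of receiver 2 per block. -/
abbrev M₂ (n : ℕ) : ℕ := numIdx n s.rate₂

/-- The codebooks for block length `n`. -/
abbrev Book (U V : Type*) (n : ℕ) :=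
  Codebook U V (s.n₁ n) (s.n₂ n) (s.M₁ n) (s.M₂ n)
    (numIdx (s.n₁ n) s.binRate₁) (numIdx (s.n₂ n) s.binRate₂)

/-- Total number of channel uses for `B` blocks of length `n`. -/
abbrev len (B n : ℕ) : ℕ := B * (s.n₁ n + s.n₂ n) + s.n₁ n

variable {X Y₁ Y₂ U V : Type*} [Fintype X] [Fintype Y₁] [Fintype Y₂] [Fintype U] [Fintype V]

/-- The scheme with block length `n`, `B` blocks and codebooks `C`. -/
def code (W : X → Y₁ × Y₂ → ℝ) (P : U × V → ℝ) (g : U → V → X) (B n : ℕ) (C : s.Book U V n) :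
    BCCode X Y₁ Y₂ (Fin B → Fin (s.M₁ n)) (Fin B → Fin (s.M₂ n)) (s.len B n) :=
  tsaCode P g (jointUY₁ W (withInput P g)) (jointVY₂ W (withInput P g)) s.εEnc s.εDec B C

end Params

section Achievability

variable {X Y₁ Y₂ U V : Type*} [Fintype X] [Fintype Y₁] [Fintype Y₂] [Fintype U] [Fintype V]

/-- Reliability of the random code ensemble: with suitable bin rates above `I(U;V)`, and for all
sufficiently small tolerances, the ensemble average of the error probability of any number of
blocks tends to zero with the block length, uniformly in the transmitted messages. -/
def EnsembleReliable (W : X → Y₁ × Y₂ → ℝ) (P : U × V → ℝ) (g : U → V → X)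
    (α R₁ R₂ : ℝ) : Prop :=
  ∃ r₁ r₂ : ℝ, mutualInfo P < r₁ ∧ mutualInfo P < r₂ ∧ ∃ ε₀ : ℝ, 0 < ε₀ ∧
    ∀ εEnc εDec : ℝ, 0 < εEnc → εEnc < εDec → εDec < ε₀ →
    ∀ s : Params, s = ⟨α, R₁, R₂, r₁, r₂, εEnc, εDec⟩ →
    ∀ B : ℕ, ∀ η : ℝ, 0 < η → ∀ᶠ n : ℕ in Filter.atTop,
      ∀ (m₁ : Fin B → Fin (s.M₁ n)) (m₂ : Fin B → Fin (s.M₂ n)),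
        Codebook.expect (fstMarginal P) (sndMarginal P)
          (fun C : s.Book U V n => (s.code W P g B n C).errProb W m₁ m₂) ≤ η

/-- The scheme with a fixed relative offset `α`, a fixed distribution `P` of `(U, V)` and
`X = g(U, V)` achieves the rate pair `R`: up to an arbitrary `δ`, the overall rates (message bits
over channel uses, start and end included) are those of `R`, with vanishing error probability. -/
def Achieves (W : X → Y₁ × Y₂ → ℝ) (P : U × V → ℝ) (g : U → V → X) (R : ℝ × ℝ) : Prop :=
  ∃ α ∈ Set.Icc (0 : ℝ) 1, ∀ δ : ℝ, 0 < δ →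
    ∃ s : Params, s.α = α ∧ 0 < s.εEnc ∧ s.εEnc < s.εDec ∧ ∃ B₀ : ℕ, ∀ B ≥ B₀,
      ∀ η : ℝ, 0 < η → ∀ᶠ n : ℕ in Filter.atTop,
        (R.1 - δ) * s.len B n ≤ Real.logb 2 (Fintype.card (Fin B → Fin (s.M₁ n))) ∧
        (R.2 - δ) * s.len B n ≤ Real.logb 2 (Fintype.card (Fin B → Fin (s.M₂ n))) ∧
        ∃ C : s.Book U V n, (s.code W P g B n C).avgErrProb W ≤ η

end Achievability

end TSA

end

/-! Decoding a block uses no other decoded block, and each receiver sees only its marginal channel.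
So the error probability is at most a sum of 2B block errors (`tsaCode_errProb_le`), each averaged
over the same ensemble, and B enters only as a factor.

Consider a block of receiver 1. Binning makes the words of the two users jointly typical for P_UV on
both parts: encoder 1 adapts to the other user on the first part, encoder 2 on the second. A bin of
rate slightly above I(U;V) contains a suitable word with high probability (covering,
`avg_no_jointly_typical_le`). Given typical inputs, Chebyshev's inequality makes the output typical
with the true words (`avg_output_not_typical_le`). The words of a wrong message are independent of
everything that produced the output (`avg_fresh_le`), so a wrong pair of message and bin index
passes both tests with probability about 2^(-n I(U;Y₁)) (packing, `avg_jointly_typical_le`). There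
are about 2^(n R₁ + n₁ R₁') such pairs with n₁ ≈ αn, hence the condition R₁ + α I(U;V) < I(U;Y₁).
These bounds meet in `avg_blockErr_le`. Receiver 2 is the same with the roles exchanged and with 1 -
α for α.

Thus the binning cost I(U;V) is divided between the users in the ratio α : 1 - α, which traces the
dominant face linearly. Every pair of Marton's region lies below some point of the face
(`exists_offset`), and the loss at the ends of the stream is of order 1/B.

For a general P_UVX, U is enlarged by an independent random function S with X = S(U,V). This keeps
I(U;V) and I(V;Y₂) and cannot decrease I(U;Y₁) (`exists_martonRegion_subset`). -/

open scoped BigOperators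

noncomputable section

namespace TSA

/-! ### Indicators and averages over finite product distributions -/

section Indicator

open Classical in
/-- The indicator of a proposition. -/
def ind (p : Prop) : ℝ := if p then 1 else 0

theorem ind_pos {p : Prop} (h : p) : ind p = 1 := if_pos h

theorem ind_neg {p : Prop} (h : ¬ p) : ind p = 0 := if_neg h

theorem ind_nonneg (p : Prop) : 0 ≤ ind p := by
  by_cases h : p
  · rw [ind_pos h]
    exact zero_le_one
  · rw [ind_neg h]

theorem ind_le_one (p : Prop) : ind p ≤ 1 := by
  by_cases h : p
  · rw [ind_pos h]
  · rw [ind_neg h]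
    exact zero_le_one

theorem ind_not (p : Prop) : ind (¬ p) = 1 - ind p := by
  by_cases h : p
  · rw [ind_pos h, ind_neg (not_not.2 h), sub_self]
  · rw [ind_neg h, ind_pos h, sub_zero]

end Indicator

section Average

variable {Ω Ω' ι κ A : Type*} [Fintype Ω] [Fintype Ω'] [Fintype ι] [Fintype κ] [Fintype A]

/-- The average of `f` with respect to the weights `w`. -/
def avg (w f : Ω → ℝ) : ℝ := ∑ s, w s * f s

/-- The weights of a product distribution. -/
def piW (w : ι → A → ℝ) (s : ι → A) : ℝ := ∏ i, w i (s i)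

theorem avg_mono {w f g : Ω → ℝ} (hw : ∀ s, 0 ≤ w s) (h : ∀ s, f s ≤ g s) :
    avg w f ≤ avg w g :=
  Finset.sum_le_sum fun s _ => mul_le_mul_of_nonneg_left (h s) (hw s)

theorem avg_nonneg {w f : Ω → ℝ} (hw : ∀ s, 0 ≤ w s) (h : ∀ s, 0 ≤ f s) : 0 ≤ avg w f :=
  Finset.sum_nonneg fun s _ => mul_nonneg (hw s) (h s)

theorem avg_add (w f g : Ω → ℝ) : avg w (fun s => f s + g s) = avg w f + avg w g := by
  simp [avg, mul_add, Finset.sum_add_distrib]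

theorem avg_mul_left (w f : Ω → ℝ) (c : ℝ) : avg w (fun s => c * f s) = c * avg w f := by
  simp only [avg, Finset.mul_sum]
  exact Finset.sum_congr rfl fun s _ => by ring

theorem avg_mul_right (w f : Ω → ℝ) (c : ℝ) : avg w (fun s => f s * c) = avg w f * c := by
  simp only [avg, Finset.sum_mul]
  exact Finset.sum_congr rfl fun s _ => by ring

theorem avg_sum {σ : Type*} (t : Finset σ) (w : Ω → ℝ) (f : σ → Ω → ℝ) :
    avg w (fun s => ∑ k ∈ t, f k s) = ∑ k ∈ t, avg w (f k) := by
  simp only [avg, Finset.mul_sum]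
  exact Finset.sum_comm

theorem avg_const {w : Ω → ℝ} (hw : w ∈ stdSimplex ℝ Ω) (c : ℝ) : avg w (fun _ => c) = c := by
  simp [avg, ← Finset.sum_mul, hw.2]

theorem avg_le {w f : Ω → ℝ} (hw : w ∈ stdSimplex ℝ Ω) {c : ℝ} (h : ∀ s, f s ≤ c) :
    avg w f ≤ c :=
  (avg_mono hw.1 h).trans_eq (avg_const hw c)

theorem avg_comm (w : Ω → ℝ) (w' : Ω' → ℝ) (f : Ω → Ω' → ℝ) :
    avg w (fun s => avg w' (f s)) = avg w' (fun t => avg w fun s => f s t) := by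
  simp only [avg, Finset.mul_sum]
  rw [Finset.sum_comm]
  exact Finset.sum_congr rfl fun s _ => Finset.sum_congr rfl fun t _ => by ring

/-- If all values exceeded `c`, the nonnegative terms `w s * (f s - c)` would have a nonpositive
sum, and all weights would vanish. This extracts a codebook from the ensemble. -/
theorem exists_le_of_avg_le {w f : Ω → ℝ} (hw : w ∈ stdSimplex ℝ Ω) {c : ℝ} (h : avg w f ≤ c) :
    ∃ s, f s ≤ c := by
  by_contra! hc
  have h0 : avg w (fun s => f s - c) ≤ 0 := by
    have := avg_add w f (fun _ => -c)
    rw [avg_const hw] at this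
    simp only [← sub_eq_add_neg] at this
    linarith
  have h1 : ∀ s ∈ Finset.univ, w s * (f s - c) = 0 := by
    have hn : ∀ s ∈ Finset.univ, 0 ≤ w s * (f s - c) :=
      fun s _ => mul_nonneg (hw.1 s) (sub_nonneg.2 (hc s).le)
    exact (Finset.sum_eq_zero_iff_of_nonneg hn).1 (le_antisymm h0 (Finset.sum_nonneg hn))
  have h2 : ∀ s, w s = 0 := fun s =>
    (mul_eq_zero.1 (h1 s (Finset.mem_univ s))).resolve_right (sub_pos.2 (hc s)).ne'
  have h3 := hw.2
  simp [h2] at h3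

variable [DecidableEq ι] [DecidableEq κ]

theorem avg_piW_prod (w f : ι → A → ℝ) :
    avg (piW w) (fun s => ∏ i, f i (s i)) = ∏ i, avg (w i) (f i) := by
  simp only [avg, piW, Finset.prod_univ_sum, ← Finset.prod_mul_distrib, Fintype.piFinset_univ]

theorem piW_mem {w : ι → A → ℝ} (hw : ∀ i, w i ∈ stdSimplex ℝ A) :
    piW w ∈ stdSimplex ℝ (ι → A) := by
  refine ⟨fun s => Finset.prod_nonneg fun i _ => (hw i).1 _, ?_⟩
  have := avg_piW_prod w (fun _ _ => 1)
  simpa [avg, (hw _).2] using this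

/-- The coordinates selected by an injection have the corresponding product distribution. -/
theorem avg_piW_comp {w : ι → A → ℝ} (hw : ∀ i, w i ∈ stdSimplex ℝ A) {j : κ → ι}
    (hj : Function.Injective j) (F : (κ → A) → ℝ) :
    avg (piW w) (fun s => F (fun k => s (j k))) = avg (piW fun k => w (j k)) F := by
  classical
  -- The strings with prescribed selected coordinates form a product set. Its weight factorizes, and
  -- the unselected coordinates contribute factors one.
  have key : ∀ z : κ → A,
      ∑ s : ι → A with (fun k => s (j k)) = z, piW w s = piW (fun k => w (j k)) z := by
    intro z
    have hset : (Finset.univ.filter fun s : ι → A => (fun k => s (j k)) = z) =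
        Fintype.piFinset fun i => Finset.univ.filter fun a => ∀ k, j k = i → a = z k := by
      ext s
      simp only [Finset.mem_filter, Finset.mem_univ, true_and, Fintype.mem_piFinset]
      constructor
      · rintro rfl i k rfl
        rfl
      · intro h
        funext k
        exact h _ k rfl
    rw [hset]
    simp only [piW]
    rw [← Finset.prod_univ_sum]
    symm
    apply Fintype.prod_of_injective j hj
    · intro i hi
      rw [Finset.filter_true_of_mem, (hw i).2]
      intro a _ k hk
      exact absurd ⟨k, hk⟩ hi
    · intro k
      have : (Finset.univ.filter fun a => ∀ k', j k' = j k → a = z k') = {z k} := by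
        ext a
        simp only [Finset.mem_filter, Finset.mem_univ, true_and, Finset.mem_singleton]
        constructor
        · intro h
          exact h k rfl
        · rintro rfl k' hk
          rw [hj hk]
      rw [this, Finset.sum_singleton]
  unfold avg
  rw [← Finset.sum_fiberwise (s := Finset.univ) (g := fun s : ι → A => fun k => s (j k))]
  refine Finset.sum_congr rfl fun z _ => ?_
  rw [← key, Finset.sum_mul]
  refine Finset.sum_congr rfl fun s hs => ?_
  rw [← (Finset.mem_filter.1 hs).2]

theorem avg_piW_eval {w : ι → A → ℝ} (hw : ∀ i, w i ∈ stdSimplex ℝ A) (i : ι) (F : A → ℝ) :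
    avg (piW w) (fun s => F (s i)) = avg (w i) F := by
  have h := avg_piW_comp hw (j := fun _ : Unit => i) (fun _ _ _ => rfl) (fun t => F (t ()))
  rw [h]
  have := avg_piW_prod (fun _ : Unit => w i) (fun _ => F)
  simpa using this

theorem avg_piW_eval₂ {w : ι → A → ℝ} (hw : ∀ i, w i ∈ stdSimplex ℝ A) {i k : ι} (hik : i ≠ k)
    (F : A → A → ℝ) :
    avg (piW w) (fun s => F (s i) (s k)) = avg (w i) fun x => avg (w k) fun y => F x y := by
  have hj : Function.Injective (![i, k] : Fin 2 → ι) := by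
    intro a b
    fin_cases a <;> fin_cases b <;> simp [hik, hik.symm]
  have h := avg_piW_comp hw hj (fun t => F (t 0) (t 1))
  simp only [Matrix.cons_val_zero, Matrix.cons_val_one] at h
  rw [h]
  unfold avg piW
  rw [← (finTwoArrowEquiv A).symm.sum_comp, Fintype.sum_prod_type]
  refine Finset.sum_congr rfl fun x _ => ?_
  rw [Finset.mul_sum]
  refine Finset.sum_congr rfl fun y _ => ?_
  simp [Fin.prod_univ_two, finTwoArrowEquiv, mul_assoc]

end Average

/-! ### Typical strings and Chebyshev bounds -/

section Typicality

variable {A B : Type*} {n : ℕ}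

/-- The tolerance is relative to `p a`, so a letter of probability zero may not occur at all. This
makes the logarithms and quotients on typical strings meaningful. -/
theorem Typical.ne_zero {p : A → ℝ} {ε : ℝ} {s : Fin n → A} (h : Typical p ε s) (i : Fin n) :
    p (s i) ≠ 0 := by
  classical
  intro h0
  have h1 := h (s i)
  rw [h0] at h1
  simp only [mul_zero, sub_zero] at h1
  have h2 : (count (s i) s : ℝ) = 0 := abs_nonpos_iff.1 h1
  have h3 : count (s i) s = 0 := by exact_mod_cast h2
  unfold count at h3
  rw [Finset.card_eq_zero, Finset.filter_eq_empty_iff] at h3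
  exact h3 (Finset.mem_univ i) rfl

theorem typical_of_length_eq_zero {p : A → ℝ} {ε : ℝ} {s : Fin n → A} (hn : n = 0) :
    Typical p ε s := by
  subst hn
  intro a
  simp [count]

theorem typical_swap_iff {p : A × B → ℝ} {ε : ℝ} {a : Fin n → A} {b : Fin n → B} :
    Typical (fun q : B × A => p q.swap) ε (fun i => (b i, a i)) ↔
      Typical p ε (fun i => (a i, b i)) := by
  have hc : ∀ (x : A) (y : B), count (y, x) (fun i => (b i, a i)) =
      count (x, y) (fun i => (a i, b i)) := by
    intro x y
    unfold count
    congr 1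
    ext i
    simp [and_comm]
  constructor
  · rintro h ⟨x, y⟩
    have := h (y, x)
    rwa [hc] at this
  · rintro h ⟨y, x⟩
    have := h (x, y)
    rwa [← hc] at this

-- The count is a sum of independent indicators. In the expanded square the off-diagonal terms have
-- mean zero and each of the `n` diagonal terms is at most one.
open Classical in
theorem avg_sq_deviation_le {Y : Type*} [Fintype Y] {w : Fin n → Y → ℝ}
    (hw : ∀ i, w i ∈ stdSimplex ℝ Y) (h : Fin n → Y → A) (a : A) :
    avg (piW w) (fun y => ((count a (fun i => h i (y i)) : ℝ)
      - ∑ i, avg (w i) (fun x => if h i x = a then 1 else 0)) ^ 2) ≤ n := by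
  set μ : Fin n → ℝ := fun i => avg (w i) (fun x => if h i x = a then 1 else 0) with hμ
  set f : Fin n → Y → ℝ := fun i x => (if h i x = a then 1 else 0) - μ i with hf
  have hμ0 : ∀ i, 0 ≤ μ i := fun i => avg_nonneg (hw i).1 fun x => by split_ifs <;> norm_num
  have hμ1 : ∀ i, μ i ≤ 1 := fun i => avg_le (hw i) fun x => by split_ifs <;> norm_num
  have hexp : ∀ y : Fin n → Y, ((count a (fun i => h i (y i)) : ℝ) - ∑ i, μ i) ^ 2 =
      ∑ i, ∑ k, f i (y i) * f k (y k) := by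
    intro y
    rw [← Finset.sum_mul_sum, ← sq]
    congr 1
    simp only [hf, Finset.sum_sub_distrib, Finset.sum_boole]
    unfold count
    congr!
  simp_rw [hexp]
  rw [avg_sum]
  have hmean : ∀ i, avg (w i) (f i) = 0 := by
    intro i
    have := avg_add (w i) (fun x => if h i x = a then 1 else 0) (fun _ => -μ i)
    rw [avg_const (hw i)] at this
    simp only [← sub_eq_add_neg] at this
    rw [hf, this]
    exact sub_self _
  have hterm : ∀ i, avg (piW w) (fun y => ∑ k, f i (y i) * f k (y k)) ≤ 1 := by
    intro i
    rw [avg_sum, Finset.sum_eq_single i]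
    · refine avg_le (piW_mem hw) fun y => ?_
      have h1 : |f i (y i)| ≤ 1 := by
        simp only [hf]
        rw [abs_le]
        have := hμ0 i
        have := hμ1 i
        split_ifs <;> constructor <;> linarith
      have h2 := sq_le_one_iff_abs_le_one (f i (y i)) |>.2 h1
      rw [← sq]
      exact h2
    · intro k _ hk
      rw [avg_piW_eval₂ hw hk.symm (fun x y => f i x * f k y)]
      simp_rw [avg_mul_left, hmean, mul_zero]
      exact avg_const (hw i) 0
    · simp
  calc _ ≤ ∑ _i : Fin n, (1 : ℝ) := Finset.sum_le_sum fun i _ => hterm i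
    _ = n := by simp

variable [Fintype A]

theorem sum_eq_sum_count (φ : A → ℝ) (s : Fin n → A) :
    ∑ i, φ (s i) = ∑ a, (count a s : ℝ) * φ a := by
  classical
  have : ∀ a, (count a s : ℝ) * φ a = ∑ i, if s i = a then φ a else 0 := by
    intro a
    rw [← Finset.sum_filter, Finset.sum_const, nsmul_eq_mul]
    unfold count
    congr!
  simp_rw [this]
  rw [Finset.sum_comm]
  simp

/-- Grouping the positions by letter transfers the relative tolerance of the counts to any additive
function. It is used for information densities and for the expected counts at a channel output. -/
theorem Typical.abs_sum_sub_le {p : A → ℝ} {ε : ℝ} {s : Fin n → A} (h : Typical p ε s)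
    (φ : A → ℝ) :
    |∑ i, φ (s i) - n * ∑ a, p a * φ a| ≤ ε * (n * ∑ a, p a * |φ a|) := by
  rw [sum_eq_sum_count, Finset.mul_sum, ← Finset.sum_sub_distrib, Finset.mul_sum, Finset.mul_sum]
  refine (Finset.abs_sum_le_sum_abs _ _).trans (Finset.sum_le_sum fun a _ => ?_)
  rw [← mul_assoc, ← sub_mul, abs_mul, ← mul_assoc, ← mul_assoc]
  have := mul_le_mul_of_nonneg_right (h a) (abs_nonneg (φ a))
  rw [← mul_assoc ε] at this
  exact this

/-- The constant in the bound on the probability of an atypical string. -/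
def atypConst (p : A → ℝ) (γ : ℝ) : ℝ := ∑ a, ((γ * p a) ^ 2)⁻¹

open Classical in
/-- Chebyshev's inequality for strings with independent letters that are typical on average. -/
theorem avg_not_typical_le {Y : Type*} [Fintype Y] {w : Fin n → Y → ℝ}
    (hw : ∀ i, w i ∈ stdSimplex ℝ Y) (h : Fin n → Y → A) {p : A → ℝ} (hp : ∀ a, 0 ≤ p a)
    {ε' ε : ℝ} (hε : ε' < ε)
    (hmean : ∀ a, |∑ i, avg (w i) (fun x => if h i x = a then 1 else 0) - n * p a| ≤
      ε' * (n * p a)) :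
    avg (piW w) (fun y => ind (¬ Typical p ε (fun i => h i (y i)))) ≤
      atypConst p (ε - ε') / n := by
  set m : A → ℝ := fun a => ∑ i, avg (w i) (fun x => if h i x = a then 1 else 0) with hm
  have hpt : ∀ y, piW w y * ind (¬ Typical p ε (fun i => h i (y i))) ≤
      piW w y * ∑ a, (((ε - ε') * (n * p a)) ^ 2)⁻¹ *
        ((count a (fun i => h i (y i)) : ℝ) - m a) ^ 2 := by
    intro y
    have hnn : ∀ a, 0 ≤ (((ε - ε') * (n * p a)) ^ 2)⁻¹ *
        ((count a (fun i => h i (y i)) : ℝ) - m a) ^ 2 := fun a => by positivity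
    rcases eq_or_ne (piW w y) 0 with h0 | h0
    · simp [h0]
    refine mul_le_mul_of_nonneg_left ?_ ((piW_mem hw).1 y)
    by_cases hT : Typical p ε (fun i => h i (y i))
    · rw [ind_neg (not_not.2 hT)]
      exact Finset.sum_nonneg fun a _ => hnn a
    · rw [ind_pos hT]
      unfold Typical at hT
      push Not at hT
      obtain ⟨a, ha⟩ := hT
      -- If `n * p a` vanishes, so does the expected count; then `a` never occurs in a string of
      -- positive weight and cannot be the letter that violates typicality.
      have hpa : n * p a ≠ 0 := by
        intro hz
        have hma := hmean a
        rw [hz, mul_zero, sub_zero] at hma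
        have hma' : m a = 0 := abs_nonpos_iff.1 hma
        have hi : ∀ i, avg (w i) (fun x => if h i x = a then 1 else 0) = 0 := by
          intro i
          refine (Finset.sum_eq_zero_iff_of_nonneg fun i _ => ?_).1 hma' i (Finset.mem_univ i)
          exact avg_nonneg (hw i).1 fun x => by split_ifs <;> norm_num
        have hcount : count a (fun i => h i (y i)) = 0 := by
          unfold count
          rw [Finset.card_eq_zero, Finset.filter_eq_empty_iff]
          intro i _ hia
          have hwi : w i (y i) * (if h i (y i) = a then 1 else 0) = 0 :=
            (Finset.sum_eq_zero_iff_of_nonneg fun x _ => mul_nonneg ((hw i).1 x)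
              (by split_ifs <;> norm_num)).1 (hi i) (y i) (Finset.mem_univ _)
          rw [if_pos hia, mul_one] at hwi
          exact h0 (Finset.prod_eq_zero (Finset.mem_univ i) hwi)
        rw [hcount, hz] at ha
        simp at ha
      have hpos : 0 < n * p a := lt_of_le_of_ne (mul_nonneg (Nat.cast_nonneg n) (hp a)) hpa.symm
      have hg : 0 < (ε - ε') * (n * p a) := mul_pos (sub_pos.2 hε) hpos
      have hdev : (ε - ε') * (n * p a) ≤ |(count a (fun i => h i (y i)) : ℝ) - m a| := by
        have h1 := abs_sub_le (count a (fun i => h i (y i)) : ℝ) (m a) (n * p a)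
        have h2 := hmean a
        have h3 : |m a - n * p a| ≤ ε' * (n * p a) := h2
        nlinarith
      have hone : 1 ≤ (((ε - ε') * (n * p a)) ^ 2)⁻¹ *
          ((count a (fun i => h i (y i)) : ℝ) - m a) ^ 2 := by
        rw [inv_mul_eq_div, one_le_div (by positivity), ← sq_abs ((count a _ : ℝ) - m a)]
        exact pow_le_pow_left₀ hg.le hdev 2
      exact hone.trans (Finset.single_le_sum (f := fun a => (((ε - ε') * (n * p a)) ^ 2)⁻¹ *
        ((count a (fun i => h i (y i)) : ℝ) - m a) ^ 2) (fun a _ => hnn a) (Finset.mem_univ a))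
  calc _ ≤ avg (piW w) (fun y => ∑ a, (((ε - ε') * (n * p a)) ^ 2)⁻¹ *
        ((count a (fun i => h i (y i)) : ℝ) - m a) ^ 2) :=
        Finset.sum_le_sum fun y _ => hpt y
    _ = ∑ a, (((ε - ε') * (n * p a)) ^ 2)⁻¹ * avg (piW w) (fun y =>
        ((count a (fun i => h i (y i)) : ℝ) - m a) ^ 2) := by
        rw [avg_sum]
        simp_rw [avg_mul_left]
    _ ≤ ∑ a, (((ε - ε') * (n * p a)) ^ 2)⁻¹ * n :=
        Finset.sum_le_sum fun a _ => mul_le_mul_of_nonneg_left (avg_sq_deviation_le hw h a)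
          (by positivity)
    -- For `n = 0` or `p a = 0` the terms vanish on both sides, by the convention that the inverse
    -- of zero is zero.
    _ = atypConst p (ε - ε') / n := by
        unfold atypConst
        rw [Finset.sum_div]
        refine Finset.sum_congr rfl fun a _ => ?_
        rcases Nat.eq_zero_or_pos n with hn | hn
        · simp [hn]
        · have : (n : ℝ) ≠ 0 := by positivity
          rcases eq_or_ne (p a) 0 with h0 | h0
          · simp [h0]
          · have : ε - ε' ≠ 0 := (sub_pos.2 hε).ne'
            field_simp

theorem avg_not_typical_iid_le {p : A → ℝ} (hp : p ∈ stdSimplex ℝ A) {ε : ℝ} (hε : 0 < ε) :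
    (∑ s : Fin n → A, piW (fun _ => p) s * ind (¬ Typical p ε s)) ≤
      atypConst p ε / n := by
  classical
  have := avg_not_typical_le (n := n) (w := fun _ => p) (fun _ => hp) (fun _ x => x) hp.1 hε
    (fun a => by simp [avg])
  rw [sub_zero] at this
  exact this

variable [Fintype B]

open Classical in
/-- If the inputs are typical then so are, with high probability, the first input and the output
of a memoryless channel. -/
theorem avg_output_not_typical_le {Y : Type*} [Fintype Y] {w : A → B → Y → ℝ}
    (hw : ∀ a b, w a b ∈ stdSimplex ℝ Y) {P : A × B → ℝ} (hP : ∀ q, 0 ≤ P q)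
    {ε' ε : ℝ} (hε : ε' < ε) {a : Fin n → A} {b : Fin n → B}
    (hT : Typical P ε' (fun i => (a i, b i))) {p : A × Y → ℝ}
    (hp : ∀ q, p q = ∑ b, P (q.1, b) * w q.1 b q.2) :
    avg (piW fun i => w (a i) (b i))
      (fun y => ind (¬ Typical p ε (fun i => (a i, y i)))) ≤
      atypConst p (ε - ε') / n := by
  refine avg_not_typical_le (fun i => hw _ _) (fun i y => (a i, y))
    (fun q => by rw [hp]; exact Finset.sum_nonneg fun b _ => mul_nonneg (hP _) ((hw _ _).1 _))
    hε ?_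
  rintro ⟨x, y⟩
  -- Given the inputs, the expected count of `(x, y)` is the sum of this function along the input
  -- pairs, so typicality of the inputs bounds its deviation.
  have h1 := hT.abs_sum_sub_le (fun q => if q.1 = x then w x q.2 y else 0)
  have habs : ∀ q : A × B, |(if q.1 = x then w x q.2 y else 0 : ℝ)| =
      if q.1 = x then w x q.2 y else 0 := fun q => by
    rw [abs_of_nonneg]
    split_ifs
    exacts [(hw _ _).1 _, le_rfl]
  simp_rw [habs] at h1
  have hsum : ∑ q : A × B, P q * (if q.1 = x then w x q.2 y else 0) = p (x, y) := by
    rw [hp, Fintype.sum_prod_type, Finset.sum_eq_single x]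
    · simp
    · intro x' _ hx
      simp [hx]
    · simp
  rw [hsum] at h1
  have hm : ∀ i, avg (w (a i) (b i)) (fun z => if (a i, z) = (x, y) then 1 else 0) =
      if a i = x then w x (b i) y else 0 := by
    intro i
    unfold avg
    by_cases hx : a i = x
    · simp [hx]
    · simp [hx]
  convert h1 using 3
  refine Finset.sum_congr rfl fun i _ => ?_
  rw [← hm]
  congr!

end Typicality

/-! ### Joint typicality: packing and covering -/

section JointTypicality

variable {A B : Type*} {n : ℕ}

section FstMarginal

variable [Fintype B]

theorem fstMarginal_nonneg {p : A × B → ℝ} (hp : ∀ q, 0 ≤ p q) (a : A) : 0 ≤ fstMarginal p a :=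
  Finset.sum_nonneg fun _ _ => hp _

theorem le_fstMarginal {p : A × B → ℝ} (hp : ∀ q, 0 ≤ p q) (q : A × B) :
    p q ≤ fstMarginal p q.1 :=
  Finset.single_le_sum (f := fun b => p (q.1, b)) (fun _ _ => hp _) (Finset.mem_univ q.2)

end FstMarginal

variable [Fintype A]

theorem sndMarginal_nonneg {p : A × B → ℝ} (hp : ∀ q, 0 ≤ p q) (b : B) : 0 ≤ sndMarginal p b :=
  Finset.sum_nonneg fun _ _ => hp _

theorem le_sndMarginal {p : A × B → ℝ} (hp : ∀ q, 0 ≤ p q) (q : A × B) :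
    p q ≤ sndMarginal p q.2 :=
  Finset.single_le_sum (f := fun a => p (a, q.2)) (fun _ _ => hp _) (Finset.mem_univ q.1)

variable [Fintype B]

/-- The information density of a joint distribution, in bits. -/
def infoDensity (p : A × B → ℝ) (q : A × B) : ℝ :=
  Real.logb 2 (p q / (fstMarginal p q.1 * sndMarginal p q.2))

/-- The mean absolute value of the information density. -/
def absInfo (p : A × B → ℝ) : ℝ := ∑ q, p q * |infoDensity p q|

theorem mutualInfo_eq_sum (p : A × B → ℝ) : mutualInfo p = ∑ q, p q * infoDensity p q := by
  rw [Fintype.sum_prod_type]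
  rfl

theorem absInfo_nonneg {p : A × B → ℝ} (hp : ∀ q, 0 ≤ p q) : 0 ≤ absInfo p :=
  Finset.sum_nonneg fun q _ => mul_nonneg (hp q) (abs_nonneg _)

theorem fstMarginal_mem {p : A × B → ℝ} (hp : p ∈ stdSimplex ℝ (A × B)) :
    fstMarginal p ∈ stdSimplex ℝ A := by
  refine ⟨fstMarginal_nonneg hp.1, ?_⟩
  rw [← hp.2, Fintype.sum_prod_type]
  rfl

theorem sndMarginal_mem {p : A × B → ℝ} (hp : p ∈ stdSimplex ℝ (A × B)) :
    sndMarginal p ∈ stdSimplex ℝ B := by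
  refine ⟨sndMarginal_nonneg hp.1, ?_⟩
  rw [← hp.2, Fintype.sum_prod_type_right]
  rfl

/-- On a jointly typical pair of strings the probability of the first string is, up to the
information density, its conditional probability given the second string. -/
theorem Typical.prod_fstMarginal_eq {p : A × B → ℝ} (hp : ∀ q, 0 ≤ p q) {ε : ℝ}
    {u : Fin n → A} {v : Fin n → B} (h : Typical p ε (fun i => (u i, v i))) :
    ∏ i, fstMarginal p (u i) = (2 : ℝ) ^ (-∑ i, infoDensity p (u i, v i)) *
      ∏ i, p (u i, v i) / sndMarginal p (v i) := by
  rw [← Finset.sum_neg_distrib, Real.rpow_sum_of_pos two_pos, ← Finset.prod_mul_distrib]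
  refine Finset.prod_congr rfl fun i _ => ?_
  have h0 : 0 < p (u i, v i) := lt_of_le_of_ne (hp _) (h.ne_zero i).symm
  have h1 := h0.trans_le (le_fstMarginal hp (u i, v i))
  have h2 := h0.trans_le (le_sndMarginal hp (u i, v i))
  unfold infoDensity
  rw [Real.rpow_neg two_pos.le, Real.rpow_logb two_pos (by norm_num) (by positivity)]
  simp only at h1 h2 ⊢
  field_simp

theorem Typical.abs_sum_infoDensity_sub_le {p : A × B → ℝ} {ε : ℝ}
    {u : Fin n → A} {v : Fin n → B} (h : Typical p ε (fun i => (u i, v i))) :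
    |∑ i, infoDensity p (u i, v i) - n * mutualInfo p| ≤ ε * (n * absInfo p) := by
  rw [mutualInfo_eq_sum]
  exact h.abs_sum_sub_le (infoDensity p)

open Classical in
/-- A fresh random word is jointly typical with a given word only with exponentially small
probability. -/
theorem avg_jointly_typical_le {p : A × B → ℝ} (hp : ∀ q, 0 ≤ p q) {ε : ℝ} (y : Fin n → B) :
    avg (piW fun _ => fstMarginal p)
      (fun u => ind (Typical p ε (fun i => (u i, y i)))) ≤
      (2 : ℝ) ^ (-(n * (mutualInfo p - ε * absInfo p))) := by
  have hc : ∀ u : Fin n → A, 0 ≤ ∏ i, p (u i, y i) / sndMarginal p (y i) := fun u =>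
    Finset.prod_nonneg fun i _ => div_nonneg (hp _) (sndMarginal_nonneg hp _)
  have hpt : ∀ u : Fin n → A, piW (fun _ => fstMarginal p) u *
      ind (Typical p ε (fun i => (u i, y i))) ≤
      (2 : ℝ) ^ (-(n * (mutualInfo p - ε * absInfo p))) *
        ∏ i, p (u i, y i) / sndMarginal p (y i) := by
    intro u
    by_cases hT : Typical p ε (fun i => (u i, y i))
    · rw [ind_pos hT, mul_one]
      unfold piW
      rw [hT.prod_fstMarginal_eq hp]
      refine mul_le_mul_of_nonneg_right ?_ (hc u)
      refine Real.rpow_le_rpow_of_exponent_le (by norm_num) ?_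
      have := (abs_le.1 hT.abs_sum_infoDensity_sub_le).1
      linarith
    · rw [ind_neg hT, mul_zero]
      exact mul_nonneg (by positivity) (hc u)
  refine (Finset.sum_le_sum fun u _ => hpt u).trans ?_
  rw [← Finset.mul_sum]
  refine mul_le_of_le_one_right (by positivity) ?_
  have := Finset.prod_univ_sum (fun _ : Fin n => (Finset.univ : Finset A))
    (fun i a => p (a, y i) / sndMarginal p (y i))
  rw [Fintype.piFinset_univ] at this
  rw [← this]
  -- Each factor is the total mass of a conditional distribution: one, or zero when `y i` has
  -- marginal probability zero.
  refine Finset.prod_le_one (fun i _ => Finset.sum_nonneg fun a _ =>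
    div_nonneg (hp _) (sndMarginal_nonneg hp _)) fun i _ => ?_
  rw [← Finset.sum_div]
  exact div_self_le_one _

open Classical in
/-- A word is typical with one of sufficiently many random words. -/
theorem avg_no_jointly_typical_le {p : A × B → ℝ} (hp : p ∈ stdSimplex ℝ (A × B)) {ε : ℝ}
    (hε : 0 < ε) (L : ℕ) :
    avg (piW fun _ : Fin n => sndMarginal p) (fun v =>
      avg (piW fun _ : Fin L => piW fun _ : Fin n => fstMarginal p) (fun x =>
        ind (¬ ∃ l, Typical p ε (fun i => (x l i, v i))))) ≤
      atypConst p ε / n +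
        Real.exp (-(L * (2 : ℝ) ^ (-(n * (mutualInfo p + ε * absInfo p))))) := by
  set c : ℝ := (2 : ℝ) ^ (-(n * (mutualInfo p + ε * absInfo p))) with hcdef
  have hc0 : 0 < c := by positivity
  -- `κ u v` is the conditional probability of `u` given `v`, and `t v` that of joint typicality
  -- with `v`. On typical pairs the unconditional probability of `u` is at least `c * κ u v`, so a
  -- fresh word is typical with `v` with probability at least `c * t v`.
  set κ : (Fin n → A) → (Fin n → B) → ℝ := fun u v => ∏ i, p (u i, v i) / sndMarginal p (v i)
  set t : (Fin n → B) → ℝ := fun v =>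
    ∑ u, κ u v * ind (Typical p ε (fun i => (u i, v i))) with ht
  have hκ : ∀ u v, 0 ≤ κ u v := fun u v =>
    Finset.prod_nonneg fun i _ => div_nonneg (hp.1 _) (sndMarginal_nonneg hp.1 _)
  have ht0 : ∀ v, 0 ≤ t v := fun v => Finset.sum_nonneg fun u _ =>
    mul_nonneg (hκ u v) (ind_nonneg _)
  have ht1 : ∀ v, t v ≤ 1 := by
    intro v
    have h1 : t v ≤ ∑ u, κ u v := Finset.sum_le_sum fun u _ =>
      mul_le_of_le_one_right (hκ u v) (ind_le_one _)
    refine h1.trans ?_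
    have := Finset.prod_univ_sum (fun _ : Fin n => (Finset.univ : Finset A))
      (fun i a => p (a, v i) / sndMarginal p (v i))
    rw [Fintype.piFinset_univ] at this
    rw [← this]
    refine Finset.prod_le_one (fun i _ => Finset.sum_nonneg fun a _ =>
      div_nonneg (hp.1 _) (sndMarginal_nonneg hp.1 _)) fun i _ => ?_
    rw [← Finset.sum_div]
    exact div_self_le_one _
  have hfst := fun _ : Fin n => fstMarginal_mem hp
  have hinner : ∀ v, avg (piW fun _ : Fin L => piW fun _ : Fin n => fstMarginal p) (fun x =>
      ind (¬ ∃ l, Typical p ε (fun i => (x l i, v i)))) ≤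
      (1 - t v) + Real.exp (-(L * c)) := by
    intro v
    set q : ℝ := avg (piW fun _ : Fin n => fstMarginal p)
      (fun u => ind (¬ Typical p ε (fun i => (u i, v i)))) with hq
    have h1 : avg (piW fun _ : Fin L => piW fun _ : Fin n => fstMarginal p) (fun x =>
        ind (¬ ∃ l, Typical p ε (fun i => (x l i, v i)))) = q ^ L := by
      have := avg_piW_prod (fun _ : Fin L => piW fun _ : Fin n => fstMarginal p)
        (fun _ u => ind (¬ Typical p ε (fun i => (u i, v i))))
      rw [Finset.prod_const, Finset.card_univ, Fintype.card_fin] at this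
      rw [hq, ← this]
      congr 1
      funext x
      by_cases h : ∃ l, Typical p ε (fun i => (x l i, v i))
      · rw [ind_neg (not_not.2 h)]
        obtain ⟨l, hl⟩ := h
        exact (Finset.prod_eq_zero (Finset.mem_univ l) (ind_neg (not_not.2 hl))).symm
      · rw [ind_pos h]
        push Not at h
        exact (Finset.prod_eq_one fun l _ => ind_pos (h l)).symm
    have hq0 : 0 ≤ q := avg_nonneg (piW_mem hfst).1 fun u => ind_nonneg _
    have hq1 : q ≤ 1 - c * t v := by
      have h2 : c * t v ≤ avg (piW fun _ : Fin n => fstMarginal p)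
          (fun u => ind (Typical p ε (fun i => (u i, v i)))) := by
        rw [ht]
        simp only [Finset.mul_sum, avg]
        refine Finset.sum_le_sum fun u _ => ?_
        by_cases hT : Typical p ε (fun i => (u i, v i))
        · rw [ind_pos hT, mul_one, mul_one]
          unfold piW
          rw [hT.prod_fstMarginal_eq hp.1]
          refine mul_le_mul_of_nonneg_right ?_ (hκ u v)
          refine Real.rpow_le_rpow_of_exponent_le (by norm_num) ?_
          have := (abs_le.1 hT.abs_sum_infoDensity_sub_le).2
          linarith
        · simp [ind_neg hT]
      have h3 := avg_add (piW fun _ : Fin n => fstMarginal p)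
        (fun u => ind (¬ Typical p ε (fun i => (u i, v i))))
        (fun u => ind (Typical p ε (fun i => (u i, v i))))
      simp only [ind_not, sub_add_cancel, avg_const (piW_mem hfst)] at h3
      simp only [hq, ind_not]
      linarith
    rw [h1]
    have h5 : q ≤ Real.exp (-(c * t v)) := by
      have := Real.add_one_le_exp (-(c * t v))
      linarith
    -- Convexity of the exponential between `0` and `-(L * c)`, with weight `t v`, separates the
    -- atypicality of `v` from the size of the bin.
    calc q ^ L ≤ Real.exp (-(c * t v)) ^ L := pow_le_pow_left₀ hq0 h5 L
      _ = Real.exp ((1 - t v) * 0 + t v * (-(L * c))) := by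
          rw [← Real.exp_nat_mul]
          congr 1
          ring
      _ ≤ (1 - t v) * Real.exp 0 + t v * Real.exp (-(L * c)) := by
          have := convexOn_exp.2 (Set.mem_univ (0 : ℝ)) (Set.mem_univ (-(L * c)))
            (sub_nonneg.2 (ht1 v)) (ht0 v) (by ring)
          simpa only [smul_eq_mul] using this
      _ ≤ (1 - t v) + Real.exp (-(L * c)) := by
          rw [Real.exp_zero, mul_one]
          have := mul_le_of_le_one_left (Real.exp_pos (-(L * c))).le (ht1 v)
          linarith
  have hsnd := fun _ : Fin n => sndMarginal_mem hp
  refine (avg_mono (piW_mem hsnd).1 hinner).trans ?_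
  rw [avg_add, avg_const (piW_mem hsnd)]
  refine add_le_add ?_ le_rfl
  -- Averaged over `v`, the conditional law `κ` yields pairs of strings i.i.d. with law `p`, for
  -- which the Chebyshev bound is available.
  have hjoint : avg (piW fun _ : Fin n => sndMarginal p) t =
      ∑ s : Fin n → A × B, piW (fun _ => p) s * ind (Typical p ε s) := by
    rw [← (Equiv.arrowProdEquivProdArrow (Fin n) (fun _ => A) (fun _ => B)).symm.sum_comp,
      Fintype.sum_prod_type_right]
    refine Finset.sum_congr rfl fun v _ => ?_
    rw [ht]
    simp only [Finset.mul_sum]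
    refine Finset.sum_congr rfl fun u _ => ?_
    rw [← mul_assoc]
    congr 1
    simp only [piW, κ]
    rw [← Finset.prod_mul_distrib]
    refine Finset.prod_congr rfl fun i _ => ?_
    change _ = p (u i, v i)
    rcases eq_or_ne (sndMarginal p (v i)) 0 with h0 | h0
    · have h1 := le_sndMarginal hp.1 (u i, v i)
      have h2 := hp.1 (u i, v i)
      simp only [h0] at h1
      rw [h0, le_antisymm h1 h2, zero_mul]
    · field_simp
  have hadd := avg_add (piW fun _ : Fin n => sndMarginal p) (fun v => 1 - t v) t
  simp only [sub_add_cancel] at hadd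
  rw [avg_const (piW_mem hsnd), hjoint] at hadd
  have htyp := avg_not_typical_iid_le (n := n) hp hε
  have hone : ∑ s : Fin n → A × B, piW (fun _ => p) s * (ind (Typical p ε s)) +
      ∑ s : Fin n → A × B, piW (fun _ => p) s * (ind (¬ Typical p ε s)) = 1 := by
    rw [← Finset.sum_add_distrib]
    refine Eq.trans ?_ (piW_mem fun _ : Fin n => hp).2
    refine Finset.sum_congr rfl fun s _ => ?_
    rw [ind_not]
    ring
  linarith

end JointTypicality

/-! ### Error probability of one block, averaged over the codebooks -/

section ProductWeights

variable {Ω Ω' : Type*} [Fintype Ω] [Fintype Ω']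

/-- The weights of the product of two distributions. -/
def prodW (w : Ω → ℝ) (w' : Ω' → ℝ) (s : Ω × Ω') : ℝ := w s.1 * w' s.2

theorem avg_prodW (w : Ω → ℝ) (w' : Ω' → ℝ) (f : Ω × Ω' → ℝ) :
    avg (prodW w w') f = avg w fun s => avg w' fun t => f (s, t) := by
  simp only [avg, prodW, Fintype.sum_prod_type, Finset.mul_sum, mul_assoc]

theorem prodW_mem {w : Ω → ℝ} {w' : Ω' → ℝ} (hw : w ∈ stdSimplex ℝ Ω)
    (hw' : w' ∈ stdSimplex ℝ Ω') : prodW w w' ∈ stdSimplex ℝ (Ω × Ω') := by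
  refine ⟨fun s => mul_nonneg (hw.1 _) (hw'.1 _), ?_⟩
  have := avg_prodW w w' fun _ => 1
  rw [avg_const hw', avg_const hw] at this
  simpa [avg] using this

/-- A word that is independent of the transmitted one is independent of the output. -/
theorem avg_fresh_le {M : ℕ} {w : Ω → ℝ} (hw : w ∈ stdSimplex ℝ Ω) {Q : Ω → Ω' → ℝ}
    (hQ : ∀ x, Q x ∈ stdSimplex ℝ Ω') {T : Ω → Ω' → ℝ} {κ : ℝ}
    (hκ : ∀ y, avg w (fun x => T x y) ≤ κ) {m m' : Fin M} (hm : m ≠ m') :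
    avg (piW fun _ : Fin M => w) (fun a => avg (Q (a m)) (T (a m'))) ≤ κ := by
  rw [avg_piW_eval₂ (fun _ => hw) hm (fun x x' => avg (Q x) (T x'))]
  refine avg_le hw fun x => ?_
  rw [avg_comm]
  exact avg_le (hQ x) hκ

end ProductWeights

section Block

open Classical in
/-- An index with the property `p`, or `0` if there is none. -/
def pick {k : ℕ} [NeZero k] (p : Fin k → Prop) : Fin k := if h : ∃ i, p i then h.choose else 0

theorem pick_spec {k : ℕ} [NeZero k] {p : Fin k → Prop} (h : ∃ i, p i) : p (pick p) := by
  unfold pick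
  rw [dif_pos h]
  exact h.choose_spec

variable {A B Y : Type*} [Fintype B] [Fintype Y]

/-- The packing bound needs words drawn from the marginal of the input-output law; this is the law
of the codebook. -/
theorem fstMarginal_output {w : A → B → Y → ℝ} (hw : ∀ a b, w a b ∈ stdSimplex ℝ Y)
    {P : A × B → ℝ} {p : A × Y → ℝ} (hp : ∀ q, p q = ∑ b, P (q.1, b) * w q.1 b q.2) :
    fstMarginal p = fstMarginal P := by
  funext a
  unfold fstMarginal
  simp_rw [hp]
  rw [Finset.sum_comm]
  refine Finset.sum_congr rfl fun b _ => ?_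
  rw [← Finset.mul_sum, (hw a b).2, mul_one]

variable [Fintype A] {n n₁ n₂ M M' L L' : ℕ}

/-- The probability that no word of a random bin is jointly typical with a given random word. -/
def binFail (P : A × B → ℝ) (ε : ℝ) (n L : ℕ) : ℝ :=
  avg (piW fun _ : Fin n => sndMarginal P) (fun v =>
    avg (piW fun _ : Fin L => piW fun _ : Fin n => fstMarginal P) (fun x =>
      ind (¬ ∃ l, Typical P ε (fun i => (x l i, v i)))))

/-- Empty words are typical, so a part of length zero, as for `α = 0` or `α = 1`, causes no binning
failure. -/
theorem binFail_zero (P : A × B → ℝ) (ε : ℝ) (L : ℕ) [NeZero L] : binFail P ε 0 L = 0 := by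
  have h : ∀ (v : Fin 0 → B) (x : Fin L → Fin 0 → A),
      ∃ l, Typical P ε (fun i => (x l i, v i)) := fun v x => ⟨0, typical_of_length_eq_zero rfl⟩
  simp [binFail, h, avg, ind_neg (p := False) id]

/-- The distribution of a pair of codebooks with independent letters. -/
def bookW (pA : A → ℝ) (pB : B → ℝ) (n₁ n₂ M M' L L' : ℕ) :
    (Fin M → Fin L → Fin n₁ → A) × (Fin M → Fin n₂ → A) ×
      (Fin M' → Fin L' → Fin n₂ → B) × (Fin M' → Fin n₁ → B) → ℝ :=
  prodW (piW fun _ => piW fun _ => piW fun _ => pA) (prodW (piW fun _ => piW fun _ => pA)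
    (prodW (piW fun _ => piW fun _ => piW fun _ => pB) (piW fun _ => piW fun _ => pB)))

theorem bookW_mem {pA : A → ℝ} {pB : B → ℝ} (hA : pA ∈ stdSimplex ℝ A)
    (hB : pB ∈ stdSimplex ℝ B) : bookW pA pB n₁ n₂ M M' L L' ∈ stdSimplex ℝ _ :=
  prodW_mem (piW_mem fun _ => piW_mem fun _ => piW_mem fun _ => hA)
    (prodW_mem (piW_mem fun _ => piW_mem fun _ => hA)
      (prodW_mem (piW_mem fun _ => piW_mem fun _ => piW_mem fun _ => hB)
        (piW_mem fun _ => piW_mem fun _ => hB)))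

/-- Lets receiver 2 be treated as receiver 1 with exchanged codebooks. -/
theorem avg_bookW_swap (pA : A → ℝ) (pB : B → ℝ)
    (F : (Fin M → Fin L → Fin n₁ → A) × (Fin M → Fin n₂ → A) ×
      (Fin M' → Fin L' → Fin n₂ → B) × (Fin M' → Fin n₁ → B) → ℝ) :
    avg (bookW pB pA n₂ n₁ M' M L' L) (fun s => F (s.2.2.1, s.2.2.2, s.1, s.2.1)) =
      avg (bookW pA pB n₁ n₂ M M' L L') F := by
  refine Fintype.sum_equiv ⟨fun s => (s.2.2.1, s.2.2.2, s.1, s.2.1),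
    fun s => (s.2.2.1, s.2.2.2, s.1, s.2.1), fun _ => rfl, fun _ => rfl⟩ _ _ fun s => ?_
  simp only [bookW, prodW, Equiv.coe_fn_mk]
  ring

variable [NeZero M] [NeZero L] [NeZero L']

/-- The probability that the decoder of a receiver errs on one block. The words `a` and `b` belong
to the Gelfand-Pinsker and the direct part of the receiver, `c` is the bin of the other
receiver that overlaps with the direct part, and `d` is the word of the other receiver
that overlaps with the Gelfand-Pinsker part. -/
def blockErr (w : A → B → Y → ℝ) (P : A × B → ℝ) (p : A × Y → ℝ) (ε' ε : ℝ)
    (a : Fin M → Fin L → Fin n₁ → A) (b : Fin M → Fin n₂ → A) (c : Fin L' → Fin n₂ → B)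
    (d : Fin n₁ → B) (m : Fin M) : ℝ :=
  avg (piW fun i => w (a m (pick fun l => Typical P ε' fun i => (a m l i, d i)) i) (d i)) fun y =>
    avg (piW fun i => w (b m i) (c (pick fun l => Typical P ε' fun i => (b m i, c l i)) i))
      fun y' => ind (¬ (pick (fun m' => ∃ l, Typical p ε (fun i => (a m' l i, y i)) ∧
        Typical p ε (fun i => (b m' i, y' i))) = m))

/-- If the true words pass both tests, the decoder has a candidate, so an error requires a wrong
message with some index that passes; a wrong index of the true message is harmless. The true words
fail a test only if binning fails or the output is atypical for typical inputs. -/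
theorem blockErr_le {w : A → B → Y → ℝ} (hw : ∀ a b, w a b ∈ stdSimplex ℝ Y) {P : A × B → ℝ}
    (hP : ∀ q, 0 ≤ P q) {p : A × Y → ℝ} (hp : ∀ q, p q = ∑ b, P (q.1, b) * w q.1 b q.2)
    {ε' ε : ℝ} (hε : ε' < ε) (a : Fin M → Fin L → Fin n₁ → A) (b : Fin M → Fin n₂ → A)
    (c : Fin L' → Fin n₂ → B) (d : Fin n₁ → B) (m : Fin M) :
    blockErr w P p ε' ε a b c d m ≤
      (ind (¬ ∃ l, Typical P ε' (fun i => (a m l i, d i))) +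
        ind (¬ ∃ l, Typical P ε' (fun i => (b m i, c l i)))) +
      (atypConst p (ε - ε') / n₁ + atypConst p (ε - ε') / n₂) +
      ∑ m' ∈ Finset.univ.erase m, ∑ l,
        avg (piW fun i => w (a m (pick fun l => Typical P ε' fun i => (a m l i, d i)) i) (d i))
          (fun y => ind (Typical p ε (fun i => (a m' l i, y i)))) *
        avg (piW fun i => w (b m i) (c (pick fun l => Typical P ε' fun i => (b m i, c l i)) i))
          (fun y' => ind (Typical p ε (fun i => (b m' i, y' i)))) := by
  unfold blockErr
  set k := pick fun l => Typical P ε' fun i => (a m l i, d i) with hk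
  set k' := pick fun l => Typical P ε' fun i => (b m i, c l i) with hk'
  have hK : 0 ≤ atypConst p (ε - ε') := Finset.sum_nonneg fun a _ => by positivity
  have hy := piW_mem fun i => hw (a m k i) (d i)
  have hy' := piW_mem fun i => hw (b m i) (c k' i)
  have hpt : ∀ (y : Fin n₁ → Y) (y' : Fin n₂ → Y),
      (ind (¬ (pick (fun m' => ∃ l, Typical p ε (fun i => (a m' l i, y i)) ∧
        Typical p ε (fun i => (b m' i, y' i))) = m))) ≤
      ((ind (¬ Typical p ε (fun i => (a m k i, y i)))) +
        (ind (¬ Typical p ε (fun i => (b m i, y' i))))) +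
      ∑ m' ∈ Finset.univ.erase m, ∑ l,
        (ind (Typical p ε (fun i => (a m' l i, y i)))) *
        (ind (Typical p ε (fun i => (b m' i, y' i)))) := by
    intro y y'
    have hs : 0 ≤ ∑ m' ∈ Finset.univ.erase m, ∑ l,
        ind (Typical p ε (fun i => (a m' l i, y i))) *
          ind (Typical p ε (fun i => (b m' i, y' i))) :=
      Finset.sum_nonneg fun _ _ => Finset.sum_nonneg fun _ _ =>
        mul_nonneg (ind_nonneg _) (ind_nonneg _)
    by_cases h1 : Typical p ε (fun i => (a m k i, y i))
    · by_cases h2 : Typical p ε (fun i => (b m i, y' i))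
      · rw [ind_neg (not_not.2 h1), ind_neg (not_not.2 h2), add_zero, zero_add]
        by_cases h3 : pick (fun m' => ∃ l, Typical p ε (fun i => (a m' l i, y i)) ∧
            Typical p ε (fun i => (b m' i, y' i))) = m
        · rw [ind_neg (not_not.2 h3)]
          exact hs
        · rw [ind_pos h3]
          obtain ⟨l, hl1, hl2⟩ := pick_spec (p := fun m' => ∃ l,
            Typical p ε (fun i => (a m' l i, y i)) ∧
            Typical p ε (fun i => (b m' i, y' i))) ⟨m, k, h1, h2⟩
          refine le_trans ?_ (Finset.single_le_sum (fun _ _ => Finset.sum_nonneg fun _ _ =>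
            mul_nonneg (ind_nonneg _) (ind_nonneg _))
            (Finset.mem_erase.2 ⟨h3, Finset.mem_univ _⟩))
          refine le_trans ?_ (Finset.single_le_sum (fun _ _ =>
            mul_nonneg (ind_nonneg _) (ind_nonneg _)) (Finset.mem_univ l))
          rw [ind_pos hl1, ind_pos hl2, one_mul]
      · rw [ind_neg (not_not.2 h1), ind_pos h2, zero_add]
        exact (ind_le_one _).trans (le_add_of_nonneg_right hs)
    · rw [ind_pos h1, add_assoc]
      exact (ind_le_one _).trans (le_add_of_nonneg_right (add_nonneg (ind_nonneg _) hs))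
  refine (avg_mono hy.1 fun y => avg_mono hy'.1 fun y' => hpt y y').trans ?_
  simp only [avg_add, avg_sum, avg_const hy', avg_const hy, avg_mul_left, avg_mul_right]
  refine add_le_add ?_ le_rfl
  rw [add_add_add_comm]
  refine add_le_add ?_ ?_
  · by_cases h : ∃ l, Typical P ε' (fun i => (a m l i, d i))
    · rw [ind_neg (not_not.2 h), zero_add]
      exact avg_output_not_typical_le hw hP hε (pick_spec h) hp
    · rw [ind_pos h]
      refine (avg_le hy (c := 1) fun y => ind_le_one _).trans ?_
      exact le_add_of_nonneg_right (by positivity)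
  · by_cases h : ∃ l, Typical P ε' (fun i => (b m i, c l i))
    · rw [ind_neg (not_not.2 h), zero_add]
      exact avg_output_not_typical_le hw hP hε (pick_spec h) hp
    · rw [ind_pos h]
      refine (avg_le hy' (c := 1) fun y => ind_le_one _).trans ?_
      exact le_add_of_nonneg_right (by positivity)

/-- The ensemble average of the error probability of a block. -/
theorem avg_blockErr_le {w : A → B → Y → ℝ} (hw : ∀ a b, w a b ∈ stdSimplex ℝ Y) {P : A × B → ℝ}
    (hP : P ∈ stdSimplex ℝ (A × B)) {p : A × Y → ℝ}
    (hp : ∀ q, p q = ∑ b, P (q.1, b) * w q.1 b q.2)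
    {ε' ε : ℝ} (hε : ε' < ε) (m : Fin M) (μ ν : Fin M') :
    avg (bookW (fstMarginal P) (sndMarginal P) n₁ n₂ M M' L L') (fun s =>
      blockErr w P p ε' ε s.1 s.2.1 (s.2.2.1 ν) (s.2.2.2 μ) m) ≤
      (binFail P ε' n₁ L + binFail (fun q => P q.swap) ε' n₂ L') +
      (atypConst p (ε - ε') / n₁ + atypConst p (ε - ε') / n₂) +
      ((M : ℝ) - 1) * (L * ((2 : ℝ) ^ (-(n₁ * (mutualInfo p - ε * absInfo p))) *
        (2 : ℝ) ^ (-(n₂ * (mutualInfo p - ε * absInfo p))))) := by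
  have hA := fstMarginal_mem hP
  have hB := sndMarginal_mem hP
  have hp0 : ∀ q, 0 ≤ p q := fun q => by
    rw [hp]
    exact Finset.sum_nonneg fun b _ => mul_nonneg (hP.1 _) ((hw _ _).1 _)
  have hW := bookW_mem (n₁ := n₁) (n₂ := n₂) (M := M) (M' := M') (L := L) (L' := L') hA hB
  have hA1 := piW_mem fun _ : Fin n₁ => hA
  have hA2 := piW_mem fun _ : Fin n₂ => hA
  have hAL := piW_mem fun _ : Fin L => hA1
  have hB1 := piW_mem fun _ : Fin n₁ => hB
  have hB2 := piW_mem fun _ : Fin n₂ => hB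
  have hBL := piW_mem fun _ : Fin L' => hB2
  have hAM := piW_mem fun _ : Fin M => hAL
  have hAD := piW_mem fun _ : Fin M => hA2
  have hBM := piW_mem fun _ : Fin M' => hBL
  have hBD := piW_mem fun _ : Fin M' => hB1
  have hpt := fun s : (Fin M → Fin L → Fin n₁ → A) × (Fin M → Fin n₂ → A) ×
      (Fin M' → Fin L' → Fin n₂ → B) × (Fin M' → Fin n₁ → B) =>
    blockErr_le hw hP.1 hp hε s.1 s.2.1 (s.2.2.1 ν) (s.2.2.2 μ) m
  refine (avg_mono hW.1 hpt).trans ?_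
  simp only [avg_add, avg_sum, avg_const hW]
  refine add_le_add (add_le_add (add_le_add (le_of_eq ?_) (le_of_eq ?_)) le_rfl) ?_
  · unfold bookW binFail
    simp only [avg_prodW, avg_const hBM, avg_const hAD]
    rw [avg_piW_eval (fun _ => hAL) m (fun x => avg (piW fun _ : Fin M' =>
      piW fun _ : Fin n₁ => sndMarginal P) fun v =>
        ind (¬ ∃ l, Typical P ε' (fun i => (x l i, v μ i))))]
    rw [avg_comm, avg_piW_eval (fun _ => hB1) μ (fun v => avg (piW fun _ : Fin L =>
      piW fun _ : Fin n₁ => fstMarginal P) fun x =>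
        ind (¬ ∃ l, Typical P ε' (fun i => (x l i, v i))))]
  · unfold bookW binFail
    simp only [avg_prodW, avg_const hBD, avg_const hAM]
    rw [avg_piW_eval (fun _ => hA2) m (fun x => avg (piW fun _ : Fin M' => piW fun _ : Fin L' =>
      piW fun _ : Fin n₂ => sndMarginal P) fun v =>
        ind (¬ ∃ l, Typical P ε' (fun i => (x i, v ν l i))))]
    change avg (piW fun _ : Fin n₂ => fstMarginal P) _ =
      avg (piW fun _ : Fin n₂ => fstMarginal P) _
    congr 1
    funext x
    rw [avg_piW_eval (fun _ => hBL) ν (fun v =>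
      ind (¬ ∃ l, Typical P ε' (fun i => (x i, v l i))))]
    simp only [typical_swap_iff]
    rfl
  · have hterm : ∀ m' ∈ Finset.univ.erase m, ∀ l : Fin L,
        avg (bookW (fstMarginal P) (sndMarginal P) n₁ n₂ M M' L L') (fun s =>
          avg (piW fun i => w (s.1 m (pick fun l => Typical P ε' fun i =>
            (s.1 m l i, s.2.2.2 μ i)) i) (s.2.2.2 μ i))
            (fun y => ind (Typical p ε (fun i => (s.1 m' l i, y i)))) *
          avg (piW fun i => w (s.2.1 m i) (s.2.2.1 ν (pick fun l => Typical P ε' fun i =>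
            (s.2.1 m i, s.2.2.1 ν l i)) i))
            (fun y' => ind (Typical p ε (fun i => (s.2.1 m' i, y' i))))) ≤
        (2 : ℝ) ^ (-(n₁ * (mutualInfo p - ε * absInfo p))) *
          (2 : ℝ) ^ (-(n₂ * (mutualInfo p - ε * absInfo p))) := by
      intro m' hm' l
      have hmm : m ≠ m' := (Finset.ne_of_mem_erase hm').symm
      unfold bookW
      simp only [avg_prodW, avg_mul_left, avg_mul_right]
      -- The test on the Gelfand-Pinsker part involves only the codebooks `a` and `d`, the test on
      -- the direct part only `b` and `c`. These are independent, so the average splits into a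
      -- product.
      refine mul_le_mul ?_ ?_ ?_ (by positivity)
      · rw [avg_comm]
        refine avg_le hBD fun d => ?_
        -- The chosen index depends on the whole bin of `m`, so independence is applied to whole
        -- bins: for fixed `d`, the bin of `m'` is independent of the output.
        refine avg_fresh_le hAL (Q := fun x => piW fun i => w (x (pick fun l =>
          Typical P ε' fun i => (x l i, d μ i)) i) (d μ i))
          (T := fun x y => ind (Typical p ε (fun i => (x l i, y i))))
          (fun x => piW_mem fun i => hw _ _) (fun y => ?_) hmm
        rw [avg_piW_eval (fun _ => hA1) l
          (fun u => ind (Typical p ε (fun i => (u i, y i)))),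
          ← fstMarginal_output hw hp]
        exact avg_jointly_typical_le hp0 y
      · rw [avg_comm]
        refine avg_le hBM fun c => ?_
        refine avg_fresh_le hA2 (Q := fun x => piW fun i => w (x i) (c ν (pick fun l =>
          Typical P ε' fun i => (x i, c ν l i)) i))
          (T := fun x y => ind (Typical p ε (fun i => (x i, y i))))
          (fun x => piW_mem fun i => hw _ _) (fun y => ?_) hmm
        rw [← fstMarginal_output hw hp]
        exact avg_jointly_typical_le hp0 y
      · exact avg_nonneg hAD.1 fun b => avg_nonneg hBM.1 fun c =>
          avg_nonneg (piW_mem fun i => hw _ _).1 fun y => ind_nonneg _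
    refine (Finset.sum_le_sum fun m' hm' => Finset.sum_le_sum fun l _ =>
      hterm m' hm' l).trans_eq ?_
    simp only [Finset.sum_const, Finset.card_univ, Fintype.card_fin, nsmul_eq_mul,
      Finset.card_erase_of_mem (Finset.mem_univ m)]
    rw [Nat.cast_sub (NeZero.one_le), Nat.cast_one]

end Block

/-! ### Mutual information inequalities -/

section Information

variable {A B S : Type*} [Fintype A] [Fintype B] [Fintype S]

/-- This is `log x ≤ x - 1` at `x = q / p`. -/
theorem sub_le_mul_logb_div {p q : ℝ} (hp : 0 ≤ p) (hq : 0 ≤ q) (h : q = 0 → p = 0) :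
    (p - q) / Real.log 2 ≤ p * Real.logb 2 (p / q) := by
  rcases hp.eq_or_lt with hp0 | hp0
  · subst hp0
    rw [zero_sub, zero_mul]
    exact div_nonpos_of_nonpos_of_nonneg (neg_nonpos.2 hq) (Real.log_nonneg one_le_two)
  have hq0 : 0 < q := lt_of_le_of_ne hq fun h0 => hp0.ne' (h h0.symm)
  have h1 := Real.log_le_sub_one_of_pos (div_pos hq0 hp0)
  rw [← inv_div, Real.log_inv] at h1
  unfold Real.logb
  rw [← mul_div_assoc]
  refine div_le_div_of_nonneg_right ?_ (Real.log_nonneg one_le_two)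
  have h2 : p * (q / p) = q := by field_simp
  rw [inv_div] at h1
  nlinarith

/-- Nonnegativity of relative entropy. -/
theorem sum_mul_logb_div_nonneg {p q : A → ℝ} (hp : ∀ a, 0 ≤ p a) (hq : ∀ a, 0 ≤ q a)
    (h : ∀ a, q a = 0 → p a = 0) (hsum : ∑ a, q a ≤ ∑ a, p a) :
    0 ≤ ∑ a, p a * Real.logb 2 (p a / q a) := by
  refine le_trans ?_ (Finset.sum_le_sum fun a _ => sub_le_mul_logb_div (hp a) (hq a) (h a))
  rw [← Finset.sum_div, Finset.sum_sub_distrib]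
  exact div_nonneg (sub_nonneg.2 hsum) (Real.log_nonneg one_le_two)

theorem mutualInfo_nonneg {p : A × B → ℝ} (hp : p ∈ stdSimplex ℝ (A × B)) :
    0 ≤ mutualInfo p := by
  rw [mutualInfo_eq_sum]
  unfold infoDensity
  refine sum_mul_logb_div_nonneg (p := p) (q := fun s => fstMarginal p s.1 * sndMarginal p s.2)
    hp.1 (fun s => mul_nonneg (fstMarginal_nonneg hp.1 _) (sndMarginal_nonneg hp.1 _)) ?_ ?_
  · intro s hs
    have h0 := hp.1 s
    rcases mul_eq_zero.1 hs with h | h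
    · exact le_antisymm (h ▸ le_fstMarginal hp.1 s) h0
    · exact le_antisymm (h ▸ le_sndMarginal hp.1 s) h0
  · rw [hp.2, Fintype.sum_prod_type]
    simp only [← Finset.mul_sum]
    rw [(sndMarginal_mem hp).2]
    simp only [mul_one]
    exact (fstMarginal_mem hp).2.le

theorem mutualInfo_swap (p : A × B → ℝ) :
    mutualInfo (fun q : B × A => p q.swap) = mutualInfo p := by
  unfold mutualInfo
  rw [Finset.sum_comm]
  refine Finset.sum_congr rfl fun a _ => Finset.sum_congr rfl fun b _ => ?_
  rw [mul_comm (fstMarginal p a)]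
  rfl

theorem mutualInfo_reindex {A' B' : Type*} [Fintype A'] [Fintype B'] (e : A' ≃ A) (f : B' ≃ B)
    (p : A × B → ℝ) : mutualInfo (fun q : A' × B' => p (e q.1, f q.2)) = mutualInfo p := by
  have h1 : ∀ a, fstMarginal (fun q : A' × B' => p (e q.1, f q.2)) a = fstMarginal p (e a) :=
    fun a => f.sum_comp fun b => p (e a, b)
  have h2 : ∀ b, sndMarginal (fun q : A' × B' => p (e q.1, f q.2)) b = sndMarginal p (f b) :=
    fun b => e.sum_comp fun a => p (a, f b)
  unfold mutualInfo
  simp only [h1, h2]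
  rw [← e.sum_comp]
  refine Finset.sum_congr rfl fun a _ => ?_
  exact f.sum_comp fun b => p (e a, b) *
    Real.logb 2 (p (e a, b) / (fstMarginal p (e a) * sndMarginal p b))

/-- Dropping a component of the first variable does not increase the mutual information. -/
theorem mutualInfo_drop_le {p : (A × S) × B → ℝ} (hp : ∀ q, 0 ≤ p q) :
    mutualInfo (fun q : A × B => ∑ s, p ((q.1, s), q.2)) ≤ mutualInfo p := by
  set r : A × B → ℝ := fun q => ∑ s, p ((q.1, s), q.2) with hr
  have hr0 : ∀ q, 0 ≤ r q := fun q => Finset.sum_nonneg fun s _ => hp _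
  have hpr : ∀ a s b, p ((a, s), b) ≤ r (a, b) := fun a s b =>
    Finset.single_le_sum (f := fun s => p ((a, s), b)) (fun _ _ => hp _) (Finset.mem_univ s)
  have hfst : ∀ a, fstMarginal r a = ∑ s, fstMarginal p (a, s) := fun a => Finset.sum_comm
  have hsnd : ∀ b, sndMarginal r b = sndMarginal p b := fun b =>
    (Fintype.sum_prod_type (fun x : A × S => p (x, b))).symm
  have hle : ∀ a s, fstMarginal p (a, s) ≤ fstMarginal r a := fun a s => by
    rw [hfst]
    exact Finset.single_le_sum (f := fun s => fstMarginal p (a, s))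
      (fun _ _ => fstMarginal_nonneg hp _) (Finset.mem_univ s)
  -- The law that makes `S` and `B` conditionally independent given `A`. The relative entropy of `p`
  -- with respect to it is I(S;B|A), the difference of the two mutual informations.
  set q : (A × S) × B → ℝ := fun x =>
    fstMarginal p x.1 * r (x.1.1, x.2) / fstMarginal r x.1.1 with hq
  have hq0 : ∀ x, 0 ≤ q x := fun x => div_nonneg
    (mul_nonneg (fstMarginal_nonneg hp _) (hr0 _)) (fstMarginal_nonneg hr0 _)
  have hqz : ∀ x, q x = 0 → p x = 0 := by
    rintro ⟨⟨a, s⟩, b⟩ h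
    refine le_antisymm ?_ (hp _)
    rcases div_eq_zero_iff.1 h with h | h
    · rcases mul_eq_zero.1 h with h | h
      · exact h ▸ le_fstMarginal hp ((a, s), b)
      · exact h ▸ hpr a s b
    · exact h ▸ (le_fstMarginal hp ((a, s), b)).trans (hle a s)
  have hsum : ∑ x, q x ≤ ∑ x, p x := by
    have h1 : ∑ x, q x ≤ ∑ a, fstMarginal r a := by
      rw [Fintype.sum_prod_type, Fintype.sum_prod_type]
      refine Finset.sum_le_sum fun a _ => ?_
      have : ∀ s, ∑ b, q ((a, s), b) = fstMarginal p (a, s) *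
          (fstMarginal r a / fstMarginal r a) := fun s => by
        simp only [hq, mul_div_assoc, ← Finset.mul_sum, ← Finset.sum_div]
        rfl
      simp only [this]
      rw [← Finset.sum_mul, ← hfst]
      exact mul_le_of_le_one_right (fstMarginal_nonneg hr0 _) (div_self_le_one _)
    refine h1.trans_eq ?_
    rw [Fintype.sum_prod_type, Fintype.sum_prod_type]
    exact Finset.sum_congr rfl fun a _ => hfst a
  have hdiff := sum_mul_logb_div_nonneg hp hq0 hqz hsum
  have hsplit : ∀ x : (A × S) × B, p x * infoDensity p x =
      p x * infoDensity r (x.1.1, x.2) + p x * Real.logb 2 (p x / q x) := by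
    rintro ⟨⟨a, s⟩, b⟩
    rcases (hp ((a, s), b)).eq_or_lt with h0 | h0
    · simp [← h0]
    have h1 := h0.trans_le (le_fstMarginal hp ((a, s), b))
    have h2 := h0.trans_le (le_sndMarginal hp ((a, s), b))
    have h3 := h0.trans_le (hpr a s b)
    have h4 := h1.trans_le (hle a s)
    simp only at h1 h2 h3 h4
    rw [← mul_add]
    congr 1
    simp only [infoDensity, hq, hsnd]
    rw [← Real.logb_mul (by positivity) (by positivity)]
    congr 1
    field_simp
  have hmarg : mutualInfo r = ∑ x : (A × S) × B, p x * infoDensity r (x.1.1, x.2) := by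
    rw [mutualInfo_eq_sum, Fintype.sum_prod_type, Fintype.sum_prod_type, Fintype.sum_prod_type]
    refine Finset.sum_congr rfl fun a _ => ?_
    rw [Finset.sum_comm]
    refine Finset.sum_congr rfl fun b _ => ?_
    simp only [← Finset.sum_mul]
    rfl
  rw [hmarg, mutualInfo_eq_sum p]
  simp only [hsplit, Finset.sum_add_distrib]
  linarith

/-- An independent component of the first variable does not change the mutual information. -/
theorem mutualInfo_mul_indep {P : A × B → ℝ} {π : S → ℝ} (hπ : ∑ s, π s = 1) :
    mutualInfo (fun q : (A × S) × B => P (q.1.1, q.2) * π q.1.2) = mutualInfo P := by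
  set p : (A × S) × B → ℝ := fun q => P (q.1.1, q.2) * π q.1.2 with hp
  have hfst : ∀ a s, fstMarginal p (a, s) = fstMarginal P a * π s := fun a s => by
    unfold fstMarginal
    rw [Finset.sum_mul]
  have hsnd : ∀ b, sndMarginal p b = sndMarginal P b := fun b => by
    unfold sndMarginal
    rw [Fintype.sum_prod_type]
    refine Finset.sum_congr rfl fun a _ => ?_
    simp only [hp, ← Finset.mul_sum]
    rw [hπ, mul_one]
  rw [mutualInfo_eq_sum, mutualInfo_eq_sum, Fintype.sum_prod_type, Fintype.sum_prod_type,
    Fintype.sum_prod_type]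
  refine Finset.sum_congr rfl fun a _ => ?_
  rw [Finset.sum_comm]
  refine Finset.sum_congr rfl fun b _ => ?_
  have : ∀ s, p ((a, s), b) * infoDensity p ((a, s), b) =
      P (a, b) * infoDensity P (a, b) * π s := by
    intro s
    rcases eq_or_ne (π s) 0 with h0 | h0
    · simp [hp, h0]
    · simp only [infoDensity, hfst, hsnd]
      rw [show fstMarginal P a * π s * sndMarginal P b = fstMarginal P a * sndMarginal P b * π s by
        ring]
      simp only [hp]
      rw [mul_div_mul_right _ _ h0]
      ring
  simp only [this, ← Finset.mul_sum]
  rw [hπ, mul_one]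

end Information

/-- Two disjoint groups of coordinates are independent. -/
theorem avg_piW_comp₂ {ι κ κ' A : Type*} [Fintype ι] [Fintype κ] [Fintype κ'] [Fintype A]
    [DecidableEq ι] [DecidableEq κ] [DecidableEq κ'] {w : ι → A → ℝ}
    (hw : ∀ i, w i ∈ stdSimplex ℝ A) {j : κ → ι} {j' : κ' → ι}
    (hj : Function.Injective (Sum.elim j j')) (F : (κ → A) → (κ' → A) → ℝ) :
    avg (piW w) (fun s => F (fun k => s (j k)) (fun k => s (j' k))) =
      avg (piW fun k => w (j k)) fun y => avg (piW fun k => w (j' k)) fun y' => F y y' := by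
  have h := avg_piW_comp hw hj (fun t => F (fun k => t (Sum.inl k)) (fun k => t (Sum.inr k)))
  simp only [Sum.elim_inl, Sum.elim_inr] at h
  rw [h]
  unfold avg piW
  rw [← (Equiv.sumArrowEquivProdArrow κ κ' A).symm.sum_comp, Fintype.sum_prod_type]
  refine Finset.sum_congr rfl fun y _ => ?_
  rw [Finset.mul_sum]
  refine Finset.sum_congr rfl fun y' _ => ?_
  simp [Fintype.prod_sum_type, Equiv.sumArrowEquivProdArrow, mul_assoc]

/-! ### Reduction of the code to marginal channels and single blocks -/

section MarginalChannels

variable {X Y₁ Y₂ : Type*} [Fintype Y₁] [Fintype Y₂]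

/-- The error probability is at most the sum of those of the two receivers. -/
theorem BCCode.errProb_le {S₁ S₂ : Type*} {N : ℕ} (c : BCCode X Y₁ Y₂ S₁ S₂ N)
    {W : X → Y₁ × Y₂ → ℝ} (hW : ∀ x, W x ∈ stdSimplex ℝ (Y₁ × Y₂)) (s₁ : S₁) (s₂ : S₂) :
    c.errProb W s₁ s₂ ≤
      avg (piW fun t => fstMarginal (W (c.enc s₁ s₂ t))) (fun y => ind (¬ c.dec₁ y = s₁)) +
      avg (piW fun t => sndMarginal (W (c.enc s₁ s₂ t))) (fun y => ind (¬ c.dec₂ y = s₂)) := by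
  set x := c.enc s₁ s₂ with hx
  -- Summing out the other receiver's outputs leaves a memoryless channel, however the two outputs
  -- are correlated.
  have h1 : ∀ y₁ : Fin N → Y₁, ∑ y₂ : Fin N → Y₂, ∏ t, W (x t) (y₁ t, y₂ t) =
      piW (fun t => fstMarginal (W (x t))) y₁ := by
    intro y₁
    unfold piW fstMarginal
    rw [Finset.prod_univ_sum, Fintype.piFinset_univ]
  have h2 : ∀ y₂ : Fin N → Y₂, ∑ y₁ : Fin N → Y₁, ∏ t, W (x t) (y₁ t, y₂ t) =
      piW (fun t => sndMarginal (W (x t))) y₂ := by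
    intro y₂
    unfold piW sndMarginal
    rw [Finset.prod_univ_sum, Fintype.piFinset_univ]
  have hpt : c.errProb W s₁ s₂ ≤ ∑ y₁ : Fin N → Y₁, ∑ y₂ : Fin N → Y₂,
      ((∏ t, W (x t) (y₁ t, y₂ t)) * ind (¬ c.dec₁ y₁ = s₁) +
        (∏ t, W (x t) (y₁ t, y₂ t)) * ind (¬ c.dec₂ y₂ = s₂)) := by
    refine Finset.sum_le_sum fun y₁ _ => Finset.sum_le_sum fun y₂ _ => ?_
    have h0 : 0 ≤ ∏ t, W (x t) (y₁ t, y₂ t) := Finset.prod_nonneg fun t _ => (hW _).1 _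
    split_ifs with h
    · exact add_nonneg (mul_nonneg h0 (ind_nonneg _)) (mul_nonneg h0 (ind_nonneg _))
    · rcases not_and_or.1 h with h | h
      · rw [ind_pos h, mul_one]
        exact le_add_of_nonneg_right (mul_nonneg h0 (ind_nonneg _))
      · rw [ind_pos h, mul_one]
        exact le_add_of_nonneg_left (mul_nonneg h0 (ind_nonneg _))
  refine hpt.trans_eq ?_
  simp only [Finset.sum_add_distrib]
  congr 1
  · refine Finset.sum_congr rfl fun y₁ _ => ?_
    rw [← Finset.sum_mul, h1]
  · rw [Finset.sum_comm]
    refine Finset.sum_congr rfl fun y₂ _ => ?_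
    rw [← Finset.sum_mul, h2]

end MarginalChannels

theorem ind_ne_le_sum {B : ℕ} {S : Type*} (m m' : Fin B → S) :
    ind (¬ m = m') ≤ ∑ b, ind (¬ m b = m' b) := by
  by_cases h : m = m'
  · rw [ind_neg (not_not.2 h)]
    exact Finset.sum_nonneg fun b _ => ind_nonneg _
  · rw [ind_pos h]
    obtain ⟨b, hb⟩ := Function.ne_iff.1 h
    refine le_trans ?_ (Finset.single_le_sum (fun b _ => ind_nonneg _) (Finset.mem_univ b))
    rw [ind_pos hb]

section Code

variable {X Y₁ Y₂ U V : Type*} {n₁ n₂ M₁ M₂ L₁ L₂ : ℕ}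
  [NeZero M₁] [NeZero M₂] [NeZero L₁] [NeZero L₂]

theorem tsaEnc_fst (P : U × V → ℝ) (g : U → V → X) (ε : ℝ) (B : ℕ)
    (C : Codebook U V n₁ n₂ M₁ M₂ L₁ L₂) (m₁ : Fin B → Fin M₁) (m₂ : Fin B → Fin M₂)
    (b : ℕ) (i : Fin n₁) (h : b * (n₁ + n₂) + i < B * (n₁ + n₂) + n₁) :
    tsaEnc P g ε B C m₁ m₂ ⟨b * (n₁ + n₂) + i, h⟩ =
      g (C.uGP (msgAt m₁ b) (C.bin₁ P ε (msgAt m₁ b) (msgBefore m₂ b)) i)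
        (C.vDir (msgBefore m₂ b) i) := by
  have hi := i.isLt
  have hdiv : (b * (n₁ + n₂) + i) / (n₁ + n₂) = b := by
    rw [Nat.mul_comm, Nat.mul_add_div (by omega), Nat.div_eq_of_lt (by omega), add_zero]
  have hmod : (b * (n₁ + n₂) + i) % (n₁ + n₂) = i := by
    rw [Nat.mul_comm, Nat.mul_add_mod, Nat.mod_eq_of_lt (by omega)]
  simp only [tsaEnc, hdiv, hmod, hi, dite_true, Fin.eta]

theorem tsaEnc_snd (P : U × V → ℝ) (g : U → V → X) (ε : ℝ) (B : ℕ)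
    (C : Codebook U V n₁ n₂ M₁ M₂ L₁ L₂) (m₁ : Fin B → Fin M₁) (m₂ : Fin B → Fin M₂)
    (b : ℕ) (i : Fin n₂) (h : b * (n₁ + n₂) + (n₁ + i) < B * (n₁ + n₂) + n₁) :
    tsaEnc P g ε B C m₁ m₂ ⟨b * (n₁ + n₂) + (n₁ + i), h⟩ =
      g (C.uDir (msgAt m₁ b) i)
        (C.vGP (msgAt m₂ b) (C.bin₂ P ε (msgAt m₁ b) (msgAt m₂ b)) i) := by
  have hi := i.isLt
  have hdiv : (b * (n₁ + n₂) + (n₁ + i)) / (n₁ + n₂) = b := by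
    rw [Nat.mul_comm, Nat.mul_add_div (by omega), Nat.div_eq_of_lt (by omega), add_zero]
  have hmod : (b * (n₁ + n₂) + (n₁ + i)) % (n₁ + n₂) = n₁ + i := by
    rw [Nat.mul_comm, Nat.mul_add_mod, Nat.mod_eq_of_lt (by omega)]
  have hlt : ¬ n₁ + (i : ℕ) < n₁ := by omega
  simp only [tsaEnc, hdiv, hmod, hlt, dite_false, Nat.add_sub_cancel_left, Fin.eta]

theorem msgAt_fin {M B : ℕ} [NeZero M] (m : Fin B → Fin M) (b : Fin B) : msgAt m b = m b := by
  simp [msgAt]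

variable (C : Codebook U V n₁ n₂ M₁ M₂ L₁ L₂)

omit [NeZero M₁] [NeZero M₂] [NeZero L₂] in
theorem Codebook.bin₁_eq_pick (P : U × V → ℝ) (ε : ℝ) (m₁ : Fin M₁) (m₂ : Fin M₂) :
    C.bin₁ P ε m₁ m₂ = pick fun l => Typical P ε (fun i => (C.uGP m₁ l i, C.vDir m₂ i)) := by
  unfold Codebook.bin₁ pick
  congr

omit [NeZero M₁] [NeZero M₂] [NeZero L₁] in
theorem Codebook.bin₂_eq_pick (P : U × V → ℝ) (ε : ℝ) (m₁ : Fin M₁) (m₂ : Fin M₂) :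
    C.bin₂ P ε m₁ m₂ = pick fun l => Typical P ε (fun i => (C.uDir m₁ i, C.vGP m₂ l i)) := by
  unfold Codebook.bin₂ pick
  congr

omit [NeZero M₂] [NeZero L₁] [NeZero L₂] in
theorem Codebook.decBlock₁_eq_pick (p : U × Y₁ → ℝ) (ε : ℝ) (y : Fin n₁ → Y₁)
    (y' : Fin n₂ → Y₁) : C.decBlock₁ p ε y y' = pick fun m => ∃ l,
      Typical p ε (fun i => (C.uGP m l i, y i)) ∧ Typical p ε (fun i => (C.uDir m i, y' i)) := by
  unfold Codebook.decBlock₁ pick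
  congr

omit [NeZero M₁] [NeZero L₁] [NeZero L₂] in
theorem Codebook.decBlock₂_eq_pick (p : V × Y₂ → ℝ) (ε : ℝ) (y : Fin n₂ → Y₂)
    (y' : Fin n₁ → Y₂) : C.decBlock₂ p ε y y' = pick fun m => ∃ l,
      Typical p ε (fun i => (C.vGP m l i, y i)) ∧ Typical p ε (fun i => (C.vDir m i, y' i)) := by
  unfold Codebook.decBlock₂ pick
  congr

variable [Fintype Y₁] [Fintype Y₂]

/-- The error probability is at most the sum of those of the individual blocks. -/
theorem tsaCode_errProb_le {W : X → Y₁ × Y₂ → ℝ} (hW : ∀ x, W x ∈ stdSimplex ℝ (Y₁ × Y₂))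
    (P : U × V → ℝ) (g : U → V → X) (p₁ : U × Y₁ → ℝ) (p₂ : V × Y₂ → ℝ) (ε' ε : ℝ) (B : ℕ)
    (m₁ : Fin B → Fin M₁) (m₂ : Fin B → Fin M₂) :
    (tsaCode P g p₁ p₂ ε' ε B C).errProb W m₁ m₂ ≤
      ∑ b : Fin B, blockErr (fun u v => fstMarginal (W (g u v))) P p₁ ε' ε C.uGP C.uDir
        (C.vGP (m₂ b)) (C.vDir (msgBefore m₂ b)) (m₁ b) +
      ∑ b : Fin B, blockErr (fun v u => sndMarginal (W (g u v))) (fun q => P q.swap) p₂ ε' ε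
        C.vGP C.vDir (C.uGP (msgAt m₁ (b + 1))) (C.uDir (m₁ b)) (m₂ b) := by
  refine (BCCode.errProb_le _ hW m₁ m₂).trans (add_le_add ?_ ?_)
  · have hw := fun t => fstMarginal_mem (hW ((tsaCode P g p₁ p₂ ε' ε B C).enc m₁ m₂ t))
    refine (avg_mono (piW_mem hw).1 fun y => ind_ne_le_sum _ _).trans ?_
    rw [avg_sum]
    refine Finset.sum_le_sum fun b _ => le_of_eq ?_
    -- The two parts occupy disjoint sets of times, so their outputs are independent given the
    -- inputs.
    have hinj : Function.Injective (Sum.elim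
        (fun i : Fin n₁ => (⟨b * (n₁ + n₂) + i, pos_lt b.isLt (by omega)⟩ :
          Fin (B * (n₁ + n₂) + n₁)))
        (fun i : Fin n₂ => ⟨b * (n₁ + n₂) + (n₁ + i), pos_lt b.isLt (by omega)⟩)) := by
      rintro (i | i) (k | k) h <;> simp only [Sum.elim_inl, Sum.elim_inr, Fin.mk.injEq] at h
      · rw [Fin.ext (show (i : ℕ) = k by omega)]
      · exact absurd i.isLt (by omega)
      · exact absurd k.isLt (by omega)
      · rw [Fin.ext (show (i : ℕ) = k by omega)]
    refine (avg_piW_comp₂ hw hinj fun y y' =>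
      ind (¬ C.decBlock₁ p₁ ε y y' = m₁ b)).trans ?_
    simp only [tsaCode, tsaEnc_fst, tsaEnc_snd, msgAt_fin, Codebook.bin₁_eq_pick,
      Codebook.bin₂_eq_pick, Codebook.decBlock₁_eq_pick]
    rfl
  · have hw := fun t => sndMarginal_mem (hW ((tsaCode P g p₁ p₂ ε' ε B C).enc m₁ m₂ t))
    refine (avg_mono (piW_mem hw).1 fun y => ind_ne_le_sum _ _).trans ?_
    rw [avg_sum]
    refine Finset.sum_le_sum fun b _ => le_of_eq ?_
    -- The direct part of block `b` of receiver 2 overlaps with the Gelfand-Pinsker part of block `b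
    -- + 1` of receiver 1. After the last block that message is the fixed one, which `msgAt`
    -- supplies.
    have hnext : ∀ i : Fin n₁, (b + 1 : ℕ) * (n₁ + n₂) + i = b * (n₁ + n₂) + (n₁ + n₂ + i) :=
      fun i => by ring
    have hlt : ∀ i : Fin n₁, (b + 1 : ℕ) * (n₁ + n₂) + i < B * (n₁ + n₂) + n₁ := fun i => by
      rw [hnext]
      exact pos_lt b.isLt (by omega)
    have hinj : Function.Injective (Sum.elim
        (fun i : Fin n₂ => (⟨b * (n₁ + n₂) + (n₁ + i), pos_lt b.isLt (by omega)⟩ :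
          Fin (B * (n₁ + n₂) + n₁)))
        (fun i : Fin n₁ => ⟨(b + 1 : ℕ) * (n₁ + n₂) + i, hlt i⟩)) := by
      rintro (i | i) (k | k) h <;> simp only [Sum.elim_inl, Sum.elim_inr, Fin.mk.injEq] at h
      · rw [Fin.ext (show (i : ℕ) = k by omega)]
      · rw [hnext] at h
        exact absurd i.isLt (by omega)
      · rw [hnext] at h
        exact absurd k.isLt (by omega)
      · rw [Fin.ext (show (i : ℕ) = k by omega)]
    have hdec : ∀ y, (tsaCode (X := X) P g p₁ p₂ ε' ε B C).dec₂ y b = C.decBlock₂ p₂ ε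
        (fun i => y ⟨b * (n₁ + n₂) + (n₁ + i), pos_lt b.isLt (by omega)⟩)
        (fun i => y ⟨(b + 1 : ℕ) * (n₁ + n₂) + i, hlt i⟩) := by
      intro y
      simp only [tsaCode, hnext]
    simp only [hdec]
    refine (avg_piW_comp₂ hw hinj fun y y' =>
      ind (¬ C.decBlock₂ p₂ ε y y' = m₂ b)).trans ?_
    simp only [tsaCode, tsaEnc_fst, tsaEnc_snd, msgAt_fin, msgBefore, Codebook.bin₁_eq_pick,
      Codebook.bin₂_eq_pick, Codebook.decBlock₂_eq_pick]
    -- Both encoders test pairs in the order `(u, v)`; the block error of receiver 2 is written for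
    -- `(v, u)`.
    unfold blockErr
    simp only [typical_swap_iff]

omit [NeZero M₁] [NeZero M₂] [NeZero L₁] [NeZero L₂] in
theorem expect_eq_avg [Fintype U] [Fintype V] (pU : U → ℝ) (pV : V → ℝ)
    (f : Codebook U V n₁ n₂ M₁ M₂ L₁ L₂ → ℝ) :
    Codebook.expect pU pV f = avg (bookW pU pV n₁ n₂ M₁ M₂ L₁ L₂)
      (fun s => f ⟨s.1, s.2.1, s.2.2.1, s.2.2.2⟩) := by
  unfold Codebook.expect avg
  simp only [Fintype.sum_prod_type, bookW, prodW, piW, mul_assoc]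

end Code

open Filter Topology

/-! ### Asymptotics of the block error bound -/

section Asymptotics

variable {A B : Type*} [Fintype A] [Fintype B]

/-- Counting only the wrong messages avoids a sign condition: for negative `R` there is one message
and the left side is zero. A bound on `numIdx n R` itself by a multiple of the power would fail
there. -/
theorem numIdx_sub_one_le (n : ℕ) (R : ℝ) : (numIdx n R : ℝ) - 1 ≤ (2 : ℝ) ^ ((n : ℝ) * R) := by
  have := Nat.ceil_lt_add_one (Real.rpow_nonneg two_pos.le ((n : ℝ) * R))
  unfold numIdx
  linarith

theorem le_numIdx (n : ℕ) (R : ℝ) : (2 : ℝ) ^ ((n : ℝ) * R) ≤ numIdx n R := Nat.le_ceil _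

theorem numIdx_le_two_mul {n : ℕ} {R : ℝ} (hR : 0 ≤ R) :
    (numIdx n R : ℝ) ≤ 2 * (2 : ℝ) ^ ((n : ℝ) * R) := by
  have h1 := numIdx_sub_one_le n R
  have h2 : 1 ≤ (2 : ℝ) ^ ((n : ℝ) * R) := Real.one_le_rpow one_le_two (by positivity)
  linarith

theorem tendsto_two_rpow_mul {c : ℝ} (hc : 0 < c) :
    Tendsto (fun n : ℕ => (2 : ℝ) ^ ((n : ℝ) * c)) atTop atTop := by
  have h : Tendsto (fun n : ℕ => ((2 : ℝ) ^ c) ^ n) atTop atTop :=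
    tendsto_pow_atTop_atTop_of_one_lt (Real.one_lt_rpow one_lt_two hc)
  refine h.congr fun n => ?_
  rw [← Real.rpow_natCast, ← Real.rpow_mul two_pos.le, mul_comm]

theorem tendsto_two_rpow_neg_mul {c : ℝ} (hc : 0 < c) :
    Tendsto (fun n : ℕ => (2 : ℝ) ^ (-((n : ℝ) * c))) atTop (𝓝 0) := by
  refine (tendsto_two_rpow_mul hc).inv_tendsto_atTop.congr fun n => ?_
  rw [Pi.inv_apply, Real.rpow_neg two_pos.le]

theorem binFail_nonneg {P : A × B → ℝ} (hP : P ∈ stdSimplex ℝ (A × B)) (ε : ℝ) (n L : ℕ) :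
    0 ≤ binFail P ε n L :=
  avg_nonneg (piW_mem fun _ => sndMarginal_mem hP).1 fun _ =>
    avg_nonneg (piW_mem fun _ => piW_mem fun _ => fstMarginal_mem hP).1 fun _ => ind_nonneg _

/-- The expected number of suitable words in the bin grows exponentially, so the second term of the
covering bound decays doubly exponentially. -/
theorem tendsto_binFail {P : A × B → ℝ} (hP : P ∈ stdSimplex ℝ (A × B)) {ε r : ℝ} (hε : 0 < ε)
    (hr : mutualInfo P + ε * absInfo P < r) :
    Tendsto (fun n : ℕ => binFail P ε n (numIdx n r)) atTop (𝓝 0) := by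
  have h1 : Tendsto (fun n : ℕ => atypConst P ε / n) atTop (𝓝 0) :=
    tendsto_const_div_atTop_nhds_zero_nat _
  have h2 : Tendsto (fun n : ℕ =>
      Real.exp (-((2 : ℝ) ^ ((n : ℝ) * (r - (mutualInfo P + ε * absInfo P)))))) atTop (𝓝 0) :=
    Real.tendsto_exp_neg_atTop_nhds_zero.comp (tendsto_two_rpow_mul (sub_pos.2 hr))
  have h3 := h1.add h2
  rw [add_zero] at h3
  refine squeeze_zero (fun n => binFail_nonneg hP _ _ _) (fun n => ?_) h3
  refine (avg_no_jointly_typical_le hP hε _).trans (add_le_add le_rfl ?_)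
  refine Real.exp_le_exp.2 (neg_le_neg ?_)
  rw [mul_sub, sub_eq_add_neg, Real.rpow_add two_pos]
  exact mul_le_mul_of_nonneg_right (le_numIdx n r) (by positivity)

/-- A sequence of lengths that is either unbounded or zero. -/
def GrowsOrZero (ℓ : ℕ → ℕ) : Prop := Tendsto ℓ atTop atTop ∨ ∀ n, ℓ n = 0

/-- Covers the extreme offsets, where one part is empty for every `n`. The bounds used then vanish
at length zero, partly because division by zero gives zero. -/
theorem GrowsOrZero.tendsto {ℓ : ℕ → ℕ} (h : GrowsOrZero ℓ) {f : ℕ → ℝ}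
    (hf : Tendsto f atTop (𝓝 0)) (h0 : f 0 = 0) : Tendsto (fun n => f (ℓ n)) atTop (𝓝 0) := by
  rcases h with h | h
  · exact hf.comp h
  · simp [h, h0]

/-- The bound on the average error probability of a block tends to zero. -/
theorem tendsto_blockErr_bound {Y : Type*} [Fintype Y] {P : A × B → ℝ}
    (hP : P ∈ stdSimplex ℝ (A × B)) {P' : B × A → ℝ} (hP' : P' ∈ stdSimplex ℝ (B × A))
    (p : A × Y → ℝ) {ε' ε α R r r' : ℝ} (hε' : 0 < ε') (hr0 : 0 ≤ r)
    (hr : mutualInfo P + ε' * absInfo P < r) (hr' : mutualInfo P' + ε' * absInfo P' < r')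
    (hR : R + α * r < mutualInfo p - ε * absInfo p) {ℓ ℓ' : ℕ → ℕ} (hℓ : GrowsOrZero ℓ)
    (hℓ' : GrowsOrZero ℓ') (hadd : ∀ n, ℓ n + ℓ' n = n) (hle : ∀ n : ℕ, (ℓ n : ℝ) ≤ α * n + 1) :
    Tendsto (fun n : ℕ =>
      (binFail P ε' (ℓ n) (numIdx (ℓ n) r) + binFail P' ε' (ℓ' n) (numIdx (ℓ' n) r')) +
      (atypConst p (ε - ε') / (ℓ n : ℕ) + atypConst p (ε - ε') / (ℓ' n : ℕ)) +
      ((numIdx n R : ℝ) - 1) * (numIdx (ℓ n) r *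
        ((2 : ℝ) ^ (-((ℓ n : ℝ) * (mutualInfo p - ε * absInfo p))) *
          (2 : ℝ) ^ (-((ℓ' n : ℝ) * (mutualInfo p - ε * absInfo p)))))) atTop (𝓝 0) := by
  set J := mutualInfo p - ε * absInfo p with hJ
  have h1 := hℓ.tendsto (tendsto_binFail hP hε' hr) (binFail_zero _ _ _)
  have h2 := hℓ'.tendsto (tendsto_binFail hP' hε' hr') (binFail_zero _ _ _)
  have hc : Tendsto (fun n : ℕ => atypConst p (ε - ε') / n) atTop (𝓝 0) :=
    tendsto_const_div_atTop_nhds_zero_nat _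
  have h3 := hℓ.tendsto hc (by simp)
  have h4 := hℓ'.tendsto hc (by simp)
  have h5 : Tendsto (fun n : ℕ => ((numIdx n R : ℝ) - 1) * (numIdx (ℓ n) r *
      ((2 : ℝ) ^ (-((ℓ n : ℝ) * J)) * (2 : ℝ) ^ (-((ℓ' n : ℝ) * J))))) atTop (𝓝 0) := by
    -- The exponent left over is `n * (J - (R + α * r))`. Rounding up the bin size costs a factor 2,
    -- and the excess of `ℓ n` over `α * n` costs `2 ^ r`.
    have h6 := (tendsto_two_rpow_neg_mul (c := J - (R + α * r)) (sub_pos.2 hR)).const_mul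
      (2 * (2 : ℝ) ^ r)
    rw [mul_zero] at h6
    refine squeeze_zero (fun n => ?_) (fun n => ?_) h6
    · have : (1 : ℝ) ≤ numIdx n R := by exact_mod_cast NeZero.one_le
      have := sub_nonneg.2 this
      positivity
    · calc _ ≤ (2 : ℝ) ^ ((n : ℝ) * R) * ((2 * (2 : ℝ) ^ ((ℓ n : ℝ) * r)) *
            ((2 : ℝ) ^ (-((ℓ n : ℝ) * J)) * (2 : ℝ) ^ (-((ℓ' n : ℝ) * J)))) := by
            gcongr
            · exact numIdx_sub_one_le n R
            · exact numIdx_le_two_mul hr0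
        _ ≤ (2 : ℝ) ^ ((n : ℝ) * R) * ((2 * (2 : ℝ) ^ ((α * n + 1) * r)) *
            ((2 : ℝ) ^ (-((ℓ n : ℝ) * J)) * (2 : ℝ) ^ (-((ℓ' n : ℝ) * J)))) := by
            gcongr
            · exact one_le_two
            · exact hle n
        _ = 2 * ((2 : ℝ) ^ ((n : ℝ) * R) * (2 : ℝ) ^ ((α * n + 1) * r) *
            ((2 : ℝ) ^ (-((ℓ n : ℝ) * J)) * (2 : ℝ) ^ (-((ℓ' n : ℝ) * J)))) := by ring
        _ = 2 * ((2 : ℝ) ^ r * (2 : ℝ) ^ (-((n : ℝ) * (J - (R + α * r))))) := by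
            have hn : ((ℓ n : ℝ)) + ℓ' n = n := by exact_mod_cast hadd n
            simp only [← Real.rpow_add two_pos]
            congr 2
            linear_combination (-J) * hn
        _ = _ := by ring
  have := ((h1.add h2).add (h3.add h4)).add h5
  simpa only [add_zero] using this

end Asymptotics

/-! ### Reliability of the random code ensemble -/

section Reliability

variable {X Y₁ Y₂ U V : Type*} [Fintype X]

theorem jointUV_withInput (P : U × V → ℝ) (g : U → V → X) : jointUV (withInput P g) = P := by
  classical
  funext q
  simp [jointUV, withInput]

/-- Presents receiver 1 as the output of a channel with input `(u, v)`, the form in which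
`blockErr_le` takes its joint law. -/
theorem jointUY₁_withInput [Fintype V] [Fintype Y₂] (W : X → Y₁ × Y₂ → ℝ) (P : U × V → ℝ)
    (g : U → V → X) (q : U × Y₁) :
    jointUY₁ W (withInput P g) q = ∑ v, P (q.1, v) * fstMarginal (W (g q.1 v)) q.2 := by
  classical
  unfold jointUY₁ fstMarginal
  refine Finset.sum_congr rfl fun v _ => ?_
  rw [Finset.sum_eq_single (g q.1 v)]
  · simp [withInput, Finset.mul_sum]
  · intro x _ hx
    simp [withInput, hx]
  · simp

theorem jointVY₂_withInput [Fintype U] [Fintype Y₁] (W : X → Y₁ × Y₂ → ℝ) (P : U × V → ℝ)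
    (g : U → V → X) (q : V × Y₂) :
    jointVY₂ W (withInput P g) q = ∑ u, P (u, q.1) * sndMarginal (W (g u q.1)) q.2 := by
  classical
  unfold jointVY₂ sndMarginal
  refine Finset.sum_congr rfl fun u _ => ?_
  rw [Finset.sum_eq_single (g u q.1)]
  · simp [withInput, Finset.mul_sum]
  · intro x _ hx
    simp [withInput, hx]
  · simp

theorem Params.n₁_le {s : Params} (h1 : s.α ≤ 1) (n : ℕ) : s.n₁ n ≤ n := by
  refine Nat.floor_le_of_le ?_
  exact mul_le_of_le_one_left (Nat.cast_nonneg n) h1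

theorem Params.n₁_add_n₂ {s : Params} (h1 : s.α ≤ 1) (n : ℕ) :
    s.n₁ n + s.n₂ n = n :=
  Nat.add_sub_cancel' (s.n₁_le h1 n)

theorem Params.growsOrZero_n₁ {s : Params} (h0 : 0 ≤ s.α) : GrowsOrZero s.n₁ := by
  rcases h0.eq_or_lt with h | h
  · right
    intro n
    simp [Params.n₁, ← h]
  · left
    exact tendsto_nat_floor_atTop.comp (tendsto_natCast_atTop_atTop.const_mul_atTop h)

theorem Params.growsOrZero_n₂ {s : Params} (h0 : 0 ≤ s.α) (h1 : s.α ≤ 1) :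
    GrowsOrZero s.n₂ := by
  rcases h1.eq_or_lt with h | h
  · right
    intro n
    simp [Params.n₂, Params.n₁, h]
  · left
    have h2 : Tendsto (fun n : ℕ => ⌊(1 - s.α) * n⌋₊) atTop atTop :=
      tendsto_nat_floor_atTop.comp
        (tendsto_natCast_atTop_atTop.const_mul_atTop (sub_pos.2 h))
    refine tendsto_atTop_mono (fun n => ?_) h2
    have h3 : (s.n₁ n : ℝ) + s.n₂ n = n := by exact_mod_cast s.n₁_add_n₂ h1 n
    have h4 : (s.n₁ n : ℝ) ≤ s.α * n := Nat.floor_le (by positivity)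
    refine Nat.floor_le_of_le ?_
    linarith

variable [Fintype Y₁] [Fintype Y₂] [Fintype U] [Fintype V]

theorem swap_mem_stdSimplex {P : U × V → ℝ} (hP : P ∈ stdSimplex ℝ (U × V)) :
    (fun q : V × U => P q.swap) ∈ stdSimplex ℝ (V × U) :=
  ⟨fun _ => hP.1 _, ((Equiv.prodComm V U).sum_comp P).trans hP.2⟩

/-- Reliability of the random code ensemble. -/
theorem ensembleReliable {W : X → Y₁ × Y₂ → ℝ} (hW : ∀ x, W x ∈ stdSimplex ℝ (Y₁ × Y₂))
    {P : U × V → ℝ} (hP : P ∈ stdSimplex ℝ (U × V)) (g : U → V → X) {α R₁ R₂ : ℝ}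
    (h0 : 0 ≤ α) (h1 : α ≤ 1)
    (hR₁ : R₁ < mutualInfo (jointUY₁ W (withInput P g)) - α * mutualInfo P)
    (hR₂ : R₂ < mutualInfo (jointVY₂ W (withInput P g)) - (1 - α) * mutualInfo P) :
    EnsembleReliable W P g α R₁ R₂ := by
  set p₁ := jointUY₁ W (withInput P g)
  set p₂ := jointVY₂ W (withInput P g)
  have hp₁ : ∀ q, p₁ q = _ := jointUY₁_withInput W P g
  have hp₂ : ∀ q, p₂ q = _ := jointVY₂_withInput W P g
  have hI := mutualInfo_nonneg hP
  set P' : V × U → ℝ := fun q => P q.swap with hP'def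
  have hP' : P' ∈ stdSimplex ℝ (V × U) := swap_mem_stdSimplex hP
  have hI' : mutualInfo P' = mutualInfo P := mutualInfo_swap P
  have hw₁ : ∀ u v, fstMarginal (W (g u v)) ∈ stdSimplex ℝ Y₁ := fun u v => fstMarginal_mem (hW _)
  have hw₂ : ∀ v u, sndMarginal (W (g u v)) ∈ stdSimplex ℝ Y₂ := fun v u => sndMarginal_mem (hW _)
  have hp₁0 : ∀ q, 0 ≤ p₁ q := fun q => by
    rw [hp₁]
    exact Finset.sum_nonneg fun _ _ => mul_nonneg (hP.1 _) ((hw₁ _ _).1 _)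
  have hp₂0 : ∀ q, 0 ≤ p₂ q := fun q => by
    rw [hp₂]
    exact Finset.sum_nonneg fun _ _ => mul_nonneg (hP.1 _) ((hw₂ _ _).1 _)
  -- The slack is spent twice: at most one `γ` on bin rates above I(U;V), less than another on the
  -- typicality tolerance of the decoder.
  obtain ⟨γ, hγ, hγ₁, hγ₂⟩ : ∃ γ > 0, R₁ + 2 * γ ≤ mutualInfo p₁ - α * mutualInfo P ∧
      R₂ + 2 * γ ≤ mutualInfo p₂ - (1 - α) * mutualInfo P := by
    refine ⟨min (mutualInfo p₁ - α * mutualInfo P - R₁)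
      (mutualInfo p₂ - (1 - α) * mutualInfo P - R₂) / 2,
      half_pos (lt_min (sub_pos.2 hR₁) (sub_pos.2 hR₂)), ?_, ?_⟩
    · linarith [min_le_left (mutualInfo p₁ - α * mutualInfo P - R₁)
        (mutualInfo p₂ - (1 - α) * mutualInfo P - R₂)]
    · linarith [min_le_right (mutualInfo p₁ - α * mutualInfo P - R₁)
        (mutualInfo p₂ - (1 - α) * mutualInfo P - R₂)]
  have hK := absInfo_nonneg hP.1
  have hK' := absInfo_nonneg hP'.1
  have hK₁ := absInfo_nonneg hp₁0
  have hK₂ := absInfo_nonneg hp₂0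
  -- One constant dominates all mean absolute information densities; the summand 1 keeps it
  -- positive, so that `γ / K` can serve as the threshold.
  set K := 1 + absInfo P + absInfo P' + absInfo p₁ + absInfo p₂ with hKdef
  have hKpos : 0 < K := by positivity
  refine ⟨mutualInfo P + γ, mutualInfo P + γ, by linarith, by linarith, γ / K,
    div_pos hγ hKpos, ?_⟩
  intro εEnc εDec hEnc hlt hDec s hs B η hη
  have hsmall : ∀ {ε k : ℝ}, 0 < ε → ε < γ / K → 0 ≤ k → k ≤ K → ε * k < γ := by
    intro ε k h2 h3 h4 h5
    have := (lt_div_iff₀ hKpos).1 h3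
    nlinarith
  have hα : s.α = α := by rw [hs]
  have hs0 : 0 ≤ s.α := hα ▸ h0
  have hs1 : s.α ≤ 1 := hα ▸ h1
  have hn := s.n₁_add_n₂ hs1
  have hrate₁ : s.rate₁ = R₁ := by rw [hs]
  have hrate₂ : s.rate₂ = R₂ := by rw [hs]
  have hbin₁ : s.binRate₁ = mutualInfo P + γ := by rw [hs]
  have hbin₂ : s.binRate₂ = mutualInfo P + γ := by rw [hs]
  have hεEnc : s.εEnc = εEnc := by rw [hs]
  have hεDec : s.εDec = εDec := by rw [hs]
  clear hs
  have hr0 : 0 ≤ mutualInfo P + γ := by positivity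
  rw [← hεEnc] at hEnc hlt
  rw [← hεDec] at hlt hDec
  have hEnc' := hlt.trans hDec
  have hDec' := hEnc.trans hlt
  have hr₁ : mutualInfo P + s.εEnc * absInfo P < s.binRate₁ := by
    rw [hbin₁]
    linarith [hsmall hEnc hEnc' hK (by linarith)]
  have hr₁' : mutualInfo P' + s.εEnc * absInfo P' < s.binRate₂ := by
    rw [hbin₂]
    linarith [hsmall hEnc hEnc' hK' (by linarith)]
  have hlow₁ : s.rate₁ + α * s.binRate₁ < mutualInfo p₁ - s.εDec * absInfo p₁ := by
    rw [hrate₁, hbin₁]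
    have := hsmall hDec' hDec hK₁ (by linarith)
    nlinarith
  have hlow₂ : s.rate₂ + (1 - α) * s.binRate₂ < mutualInfo p₂ - s.εDec * absInfo p₂ := by
    rw [hrate₂, hbin₂]
    have := hsmall hDec' hDec hK₂ (by linarith)
    nlinarith
  have hle₁ : ∀ n : ℕ, (s.n₁ n : ℝ) ≤ α * n + 1 := fun n => by
    have : (s.n₁ n : ℝ) ≤ s.α * n := Nat.floor_le (by positivity)
    rw [hα] at this
    linarith
  -- Since `n₁` is rounded down, `n₂` can exceed `(1 - α) * n`, by at most one.
  have hle₂ : ∀ n : ℕ, (s.n₂ n : ℝ) ≤ (1 - α) * n + 1 := fun n => by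
    have h3 : (s.n₁ n : ℝ) + s.n₂ n = n := by exact_mod_cast hn n
    have h4 := (Nat.lt_floor_add_one (s.α * n)).le
    change s.α * n ≤ (s.n₁ n : ℝ) + 1 at h4
    rw [hα] at h4
    linarith
  have hlim₁ := tendsto_blockErr_bound hP hP' p₁ hEnc (hbin₁ ▸ hr0) hr₁ hr₁' hlow₁
    (s.growsOrZero_n₁ hs0) (s.growsOrZero_n₂ hs0 hs1) hn hle₁
  have hlim₂ := tendsto_blockErr_bound hP' hP p₂ hEnc (hbin₂ ▸ hr0) hr₁' hr₁ hlow₂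
    (s.growsOrZero_n₂ hs0 hs1) (s.growsOrZero_n₁ hs0) (fun n => by rw [add_comm, hn n]) hle₂
  have hlim := (hlim₁.add hlim₂).const_mul (B : ℝ)
  rw [add_zero, mul_zero] at hlim
  filter_upwards [hlim.eventually (ge_mem_nhds hη)] with n hbound m₁ m₂
  refine le_trans ?_ hbound
  have hbook := bookW_mem (n₁ := s.n₁ n) (n₂ := s.n₂ n) (M := s.M₁ n) (M' := s.M₂ n)
    (L := numIdx (s.n₁ n) s.binRate₁) (L' := numIdx (s.n₂ n) s.binRate₂)
    (fstMarginal_mem hP) (sndMarginal_mem hP)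
  rw [expect_eq_avg]
  refine (avg_mono hbook.1 fun C => tsaCode_errProb_le _ hW _ g _ _ _ _ B m₁ m₂).trans ?_
  rw [avg_add, avg_sum, avg_sum, mul_add]
  refine add_le_add ?_ ?_
  · refine (Finset.sum_le_card_nsmul _ _ _ fun b _ => avg_blockErr_le hw₁ hP hp₁
      hlt (m₁ b) (msgBefore m₂ b) (m₂ b)).trans_eq ?_
    rw [Finset.card_univ, Fintype.card_fin, nsmul_eq_mul]
  -- Receiver 2 is receiver 1 of the scheme with reversed joint law `P'` and interchanged part
  -- lengths.
  · refine (Finset.sum_le_card_nsmul _ _ _ fun (b : Fin B) _ => (avg_bookW_swap (fstMarginal P')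
      (sndMarginal P') fun C => blockErr (fun v u => sndMarginal (W (g u v))) P' p₂ s.εEnc s.εDec
        C.1 C.2.1 (C.2.2.1 (msgAt m₁ (b + 1))) (C.2.2.2 (m₁ b)) (m₂ b)).le.trans
      (avg_blockErr_le hw₂ hP' hp₂ hlt (m₂ b) (m₁ b) (msgAt m₁ (b + 1)))).trans_eq ?_
    rw [Finset.card_univ, Fintype.card_fin, nsmul_eq_mul]
    rfl

end Reliability

/-! ### Geometry of the dominant face -/

section DominantFace

theorem image_offset_eq_dominantFace {I₁ I₂ I : ℝ} (hI : 0 ≤ I) :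
    (fun α : ℝ => (I₁ - α * I, I₂ - (1 - α) * I)) '' Set.Icc 0 1 =
      {R : ℝ × ℝ | R.1 ≤ I₁ ∧ R.2 ≤ I₂ ∧ R.1 + R.2 = I₁ + I₂ - I} := by
  ext ⟨R₁, R₂⟩
  simp only [Set.mem_image, Set.mem_Icc, Prod.mk.injEq, Set.mem_ofPred_eq]
  constructor
  · rintro ⟨α, ⟨h0, h1⟩, rfl, rfl⟩
    have h2 := mul_nonneg h0 hI
    have h3 := mul_nonneg (sub_nonneg.2 h1) hI
    refine ⟨?_, ?_, ?_⟩ <;> linarith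
  · rintro ⟨h1, h2, h3⟩
    -- For `I = 0` the face is a single point and any offset works; otherwise the first coordinate
    -- determines `α`.
    rcases hI.eq_or_lt with h | h
    · refine ⟨0, ⟨le_rfl, zero_le_one⟩, ?_, ?_⟩ <;> rw [← h] <;> linarith
    · have h4 : (I₁ - R₁) / I * I = I₁ - R₁ := div_mul_cancel₀ _ h.ne'
      refine ⟨(I₁ - R₁) / I, ⟨div_nonneg (by linarith) hI, ?_⟩, ?_, ?_⟩
      · rw [div_le_one h]
        linarith
      · linarith
      · linarith

theorem image_offset_eq_segment (I₁ I₂ I : ℝ) :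
    (fun α : ℝ => (I₁ - α * I, I₂ - (1 - α) * I)) '' Set.Icc 0 1 =
      segment ℝ (I₁, I₂ - I) (I₁ - I, I₂) := by
  rw [segment_eq_image]
  refine Set.image_congr fun α _ => ?_
  simp only [Prod.smul_mk, Prod.mk_add_mk, smul_eq_mul, Prod.mk.injEq]
  constructor <;> ring

/-- Every point of Marton's region is dominated by a point of the dominant face. -/
theorem exists_offset {I₁ I₂ I R₁ R₂ : ℝ} (hI : 0 ≤ I) (h1 : R₁ ≤ I₁) (h2 : R₂ ≤ I₂)
    (h3 : R₁ + R₂ ≤ I₁ + I₂ - I) :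
    ∃ α ∈ Set.Icc (0 : ℝ) 1, R₁ ≤ I₁ - α * I ∧ R₂ ≤ I₂ - (1 - α) * I := by
  -- If `R₁` leaves room for the whole cost `I`, user 1 bears all of it. Otherwise `α` is chosen to
  -- make the first bound tight, and the sum bound gives the second.
  rcases le_total I (I₁ - R₁) with h | h
  · exact ⟨1, ⟨zero_le_one, le_rfl⟩, by linarith, by linarith⟩
  · rcases hI.eq_or_lt with h0 | h0
    · exact ⟨0, ⟨le_rfl, zero_le_one⟩, by rw [← h0]; linarith, by rw [← h0]; linarith⟩
    · have h4 : (I₁ - R₁) / I * I = I₁ - R₁ := div_mul_cancel₀ _ h0.ne'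
      refine ⟨(I₁ - R₁) / I, ⟨div_nonneg (by linarith) hI, (div_le_one h0).2 h⟩, ?_, ?_⟩ <;>
        linarith

end DominantFace

/-! ### Codes and overall rates -/

section Achievability

variable {X Y₁ Y₂ U V : Type*} [Fintype X] [Fintype Y₁] [Fintype Y₂] [Fintype U] [Fintype V]

/-- The ends cost at most one extra block length, and `(R - δ) * (B + 1) ≤ B * (R - δ / 2)` once `B
* δ ≥ 2 * R`. If `R - δ ≤ 0` the bound is trivial. -/
theorem mul_rate_le_logb_card {B n M n₁ : ℕ} {R δ : ℝ} (hδ : 0 < δ) (hB : 2 * R / δ ≤ B)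
    (hn₁ : n₁ ≤ n) (hM : (2 : ℝ) ^ ((n : ℝ) * (R - δ / 2)) ≤ M) :
    (R - δ) * ((B * n + n₁ : ℕ) : ℝ) ≤ Real.logb 2 (Fintype.card (Fin B → Fin M)) := by
  have hMpos : (0 : ℝ) < M := lt_of_lt_of_le (by positivity) hM
  have hM1 : (1 : ℝ) ≤ M := by
    exact_mod_cast Nat.one_le_iff_ne_zero.2 (by rintro rfl; simp at hMpos)
  have hlog : (n : ℝ) * (R - δ / 2) ≤ Real.logb 2 M :=
    (Real.le_logb_iff_rpow_le one_lt_two hMpos).2 hM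
  have hlog0 : 0 ≤ Real.logb 2 M := Real.logb_nonneg one_lt_two hM1
  rw [Fintype.card_fun, Fintype.card_fin, Fintype.card_fin, Nat.cast_pow, Real.logb_pow]
  rcases le_total (R - δ) 0 with h | h
  · exact (mul_nonpos_of_nonpos_of_nonneg h (Nat.cast_nonneg _)).trans
      (mul_nonneg (Nat.cast_nonneg _) hlog0)
  · rw [div_le_iff₀ hδ] at hB
    have h1 : (n₁ : ℝ) ≤ n := by exact_mod_cast hn₁
    have hn0 : (0 : ℝ) ≤ n := Nat.cast_nonneg n
    push_cast
    calc (R - δ) * (B * n + n₁) ≤ (R - δ) * (B * n + n) := by gcongr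
      _ ≤ B * (n * (R - δ / 2)) := by nlinarith
      _ ≤ B * Real.logb 2 M := by gcongr

/-- A pair that is dominated by a point on the dominant face is achieved. -/
theorem achieves_of_le {W : X → Y₁ × Y₂ → ℝ} (hW : ∀ x, W x ∈ stdSimplex ℝ (Y₁ × Y₂))
    {P : U × V → ℝ} (hP : P ∈ stdSimplex ℝ (U × V)) (g : U → V → X) {R : ℝ × ℝ} {α : ℝ}
    (hα : α ∈ Set.Icc (0 : ℝ) 1)
    (h1 : R.1 ≤ mutualInfo (jointUY₁ W (withInput P g)) - α * mutualInfo P)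
    (h2 : R.2 ≤ mutualInfo (jointVY₂ W (withInput P g)) - (1 - α) * mutualInfo P) :
    Achieves W P g R := by
  refine ⟨α, hα, fun δ hδ => ?_⟩
  obtain ⟨r₁, r₂, -, -, ε₀, hε₀, hrel⟩ := ensembleReliable hW hP g hα.1 hα.2
    (R₁ := R.1 - δ / 2) (R₂ := R.2 - δ / 2) (by linarith) (by linarith)
  -- Half of `δ` makes the block rates strictly smaller than the bounds; the other half absorbs the
  -- loss at the ends.
  set s : Params := ⟨α, R.1 - δ / 2, R.2 - δ / 2, r₁, r₂, ε₀ / 3, ε₀ / 2⟩ with hs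
  refine ⟨s, rfl, by positivity, ?_, max ⌈2 * R.1 / δ⌉₊ ⌈2 * R.2 / δ⌉₊, fun B hB η hη => ?_⟩
  · change ε₀ / 3 < ε₀ / 2
    linarith
  have hB₁ : 2 * R.1 / δ ≤ B :=
    (Nat.le_ceil _).trans (by exact_mod_cast (le_max_left _ _).trans hB)
  have hB₂ : 2 * R.2 / δ ≤ B :=
    (Nat.le_ceil _).trans (by exact_mod_cast (le_max_right _ _).trans hB)
  filter_upwards [hrel _ _ (by positivity) (by linarith) (by linarith) s hs B η hη] with n hn
  have hle : s.n₁ n ≤ n := s.n₁_le hα.2 n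
  have hadd : s.n₁ n + s.n₂ n = n := s.n₁_add_n₂ hα.2 n
  refine ⟨?_, ?_, ?_⟩
  · unfold Params.len
    rw [hadd]
    exact mul_rate_le_logb_card hδ hB₁ hle (le_numIdx n _)
  · unfold Params.len
    rw [hadd]
    exact mul_rate_le_logb_card hδ hB₂ hle (le_numIdx n _)
  · have hbook := bookW_mem (n₁ := s.n₁ n) (n₂ := s.n₂ n) (M := s.M₁ n) (M' := s.M₂ n)
      (L := numIdx (s.n₁ n) s.binRate₁) (L' := numIdx (s.n₂ n) s.binRate₂)
      (fstMarginal_mem hP) (sndMarginal_mem hP)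
    simp only [expect_eq_avg] at hn
    -- The ensemble bound holds for every message pair, hence for the average over messages;
    -- exchanging the two averages, some codebook is as good as the ensemble.
    suffices h : avg (bookW (fstMarginal P) (sndMarginal P) (s.n₁ n) (s.n₂ n) (s.M₁ n) (s.M₂ n)
        (numIdx (s.n₁ n) s.binRate₁) (numIdx (s.n₂ n) s.binRate₂)) (fun C =>
        (s.code W P g B n ⟨C.1, C.2.1, C.2.2.1, C.2.2.2⟩).avgErrProb W) ≤ η by
      obtain ⟨C, hC⟩ := exists_le_of_avg_le hbook h
      exact ⟨_, hC⟩
    unfold BCCode.avgErrProb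
    simp only [div_eq_mul_inv]
    rw [avg_mul_right, avg_sum, ← div_eq_mul_inv, div_le_iff₀ (by
      have : Nonempty (Fin (s.M₁ n)) := ⟨0⟩
      have : Nonempty (Fin (s.M₂ n)) := ⟨0⟩
      have h3 := Fintype.card_pos (α := Fin B → Fin (s.M₁ n))
      have h4 := Fintype.card_pos (α := Fin B → Fin (s.M₂ n))
      positivity)]
    simp only [avg_sum]
    refine (Finset.sum_le_sum fun m₁ _ => Finset.sum_le_sum fun m₂ _ => hn m₁ m₂).trans_eq ?_
    simp only [Finset.sum_const, Finset.card_univ, nsmul_eq_mul]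
    ring

/-- The scheme achieves Marton's region when the input is a function of the auxiliary letters. -/
theorem achieves_of_mem_martonRegion {W : X → Y₁ × Y₂ → ℝ}
    (hW : ∀ x, W x ∈ stdSimplex ℝ (Y₁ × Y₂)) {P : U × V → ℝ} (hP : P ∈ stdSimplex ℝ (U × V))
    (g : U → V → X) {R : ℝ × ℝ} (hR : R ∈ martonRegion W (withInput P g)) :
    Achieves W P g R := by
  obtain ⟨-, -, h1, h2, h3⟩ := hR
  rw [jointUV_withInput] at h3
  obtain ⟨α, hα, h4, h5⟩ := exists_offset (mutualInfo_nonneg hP) h1 h2 h3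
  exact achieves_of_le hW hP g hα h4 h5

end Achievability

/-! ### Reduction of a general input to a function of the auxiliary letters -/

section FunctionalRepresentation

variable {X Y₁ Y₂ U V : Type*} [Fintype X] [Fintype Y₁] [Fintype Y₂] [Fintype U] [Fintype V]

theorem jointUV_mem {Q : U × V × X → ℝ} (hQ : Q ∈ stdSimplex ℝ (U × V × X)) :
    jointUV Q ∈ stdSimplex ℝ (U × V) := by
  refine ⟨fun _ => Finset.sum_nonneg fun _ _ => hQ.1 _, ?_⟩
  rw [← hQ.2, Fintype.sum_prod_type, Fintype.sum_prod_type]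
  refine Finset.sum_congr rfl fun u _ => ?_
  rw [Fintype.sum_prod_type]
  rfl

/-- A conditional distribution of `X` given `(U, V)`. -/
theorem exists_condDistrib {Q : U × V × X → ℝ} (hQ : Q ∈ stdSimplex ℝ (U × V × X)) :
    ∃ κ : U → V → X → ℝ, (∀ u v, κ u v ∈ stdSimplex ℝ X) ∧
      ∀ u v x, jointUV Q (u, v) * κ u v x = Q (u, v, x) := by
  classical
  have hne : Nonempty X := by
    by_contra h
    have : IsEmpty X := not_nonempty_iff.1 h
    have := hQ.2
    simp at this
  obtain ⟨x₀⟩ := hne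
  -- On pairs `(u, v)` of probability zero any distribution serves; a point mass is used.
  refine ⟨fun u v => if jointUV Q (u, v) = 0 then Pi.single x₀ 1 else
    fun x => Q (u, v, x) / jointUV Q (u, v), fun u v => ?_, fun u v x => ?_⟩
  · dsimp only
    split_ifs with h
    · exact single_mem_stdSimplex ℝ x₀
    · refine ⟨fun x => div_nonneg (hQ.1 _) ((jointUV_mem hQ).1 _), ?_⟩
      rw [← Finset.sum_div]
      exact div_self h
  · dsimp only
    split_ifs with h
    · rw [h, zero_mul]
      exact ((Finset.sum_eq_zero_iff_of_nonneg fun x _ => hQ.1 (u, v, x)).1 h x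
        (Finset.mem_univ x)).symm
    · exact mul_div_cancel₀ _ h

open Classical in
/-- Every distribution of `(U, V, X)` is the one induced by some `((U, S), V)` and a function `g`
of it, where `S` is independent of `(U, V)`. -/
theorem exists_functional_representation {Q : U × V × X → ℝ}
    (hQ : Q ∈ stdSimplex ℝ (U × V × X)) :
    ∃ π : (U → V → X) → ℝ, π ∈ stdSimplex ℝ (U → V → X) ∧ ∀ u v x,
      ∑ s : U → V → X, (if x = s u v then jointUV Q (u, v) * π s else 0) = Q (u, v, x) := by
  obtain ⟨κ, hκ, hQκ⟩ := exists_condDistrib hQ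
  have hκ' := fun u => piW_mem (hκ u)
  -- `S` is a random table with independent entries, the entry at `(u, v)` having law `κ u v`;
  -- reading it at `(U, V)` reproduces the conditional law of `X`.
  refine ⟨piW fun u => piW (κ u), piW_mem hκ', fun u v x => ?_⟩
  have h1 := avg_piW_eval hκ' u (fun t : V → X => if x = t v then (1 : ℝ) else 0)
  have h2 := avg_piW_eval (hκ u) v (fun y : X => if x = y then (1 : ℝ) else 0)
  have h3 : avg (κ u v) (fun y : X => if x = y then (1 : ℝ) else 0) = κ u v x := by
    simp [avg]
  rw [h2, h3] at h1
  rw [← hQκ, ← h1, avg, Finset.mul_sum]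
  refine Finset.sum_congr rfl fun s _ => ?_
  split_ifs <;> simp

/-- Marton's region for an arbitrary input is contained in one where the input is a function of
the auxiliary letters. -/
theorem exists_martonRegion_subset (W : X → Y₁ × Y₂ → ℝ) (hW : ∀ x, W x ∈ stdSimplex ℝ (Y₁ × Y₂))
    {Q : U × V × X → ℝ} (hQ : Q ∈ stdSimplex ℝ (U × V × X)) :
    ∃ (k l : ℕ) (P : Fin k × Fin l → ℝ) (g : Fin k → Fin l → X),
      P ∈ stdSimplex ℝ (Fin k × Fin l) ∧ martonRegion W Q ⊆ martonRegion W (withInput P g) := by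
  classical
  obtain ⟨π, hπ, hQπ⟩ := exists_functional_representation hQ
  set e := (Fintype.equivFin (U × (U → V → X))).symm
  set f := (Fintype.equivFin V).symm
  -- The new first letter is `(U, S)`. Dropping `S` gives I(U;Y₁) ≤ I(U,S;Y₁), the law of `(V, Y₂)`
  -- is unchanged, and independence of `S` preserves the information between the auxiliary letters.
  set P' : (U × (U → V → X)) × V → ℝ := fun q => jointUV Q (q.1.1, q.2) * π q.1.2 with hP'
  set g' : U × (U → V → X) → V → X := fun q v => q.2 q.1 v with hg'
  have hP'0 : ∀ q, 0 ≤ P' q := fun q => mul_nonneg ((jointUV_mem hQ).1 _) (hπ.1 _)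
  have hP'1 : ∑ q, P' q = 1 := by
    rw [← (jointUV_mem hQ).2, Fintype.sum_prod_type, Fintype.sum_prod_type, Fintype.sum_prod_type]
    refine Finset.sum_congr rfl fun u _ => ?_
    rw [Finset.sum_comm]
    refine Finset.sum_congr rfl fun v _ => ?_
    simp only [hP', ← Finset.mul_sum]
    rw [hπ.2, mul_one]
  have hcond : ∀ u v (h : X → ℝ), ∑ s, P' ((u, s), v) * h (g' (u, s) v) =
      ∑ x, Q (u, v, x) * h x := by
    intro u v h
    simp only [← hQπ, Finset.sum_mul]
    rw [Finset.sum_comm]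
    refine Finset.sum_congr rfl fun s _ => ?_
    rw [Finset.sum_eq_single (s u v)]
    · rw [if_pos rfl]
    · intro x _ hx
      rw [if_neg hx, zero_mul]
    · simp
  have hUY : jointUY₁ W Q = fun q => ∑ s, jointUY₁ W (withInput P' g') ((q.1, s), q.2) := by
    funext ⟨u, y⟩
    simp only [jointUY₁_withInput]
    rw [Finset.sum_comm]
    refine Finset.sum_congr rfl fun v _ => ?_
    rw [hcond u v fun x => fstMarginal (W x) y]
    refine Finset.sum_congr rfl fun x _ => ?_
    rw [← Finset.mul_sum]
    rfl
  have hVY : jointVY₂ W Q = jointVY₂ W (withInput P' g') := by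
    funext ⟨v, y⟩
    rw [jointVY₂_withInput, Fintype.sum_prod_type]
    refine Finset.sum_congr rfl fun u _ => ?_
    rw [hcond u v fun x => sndMarginal (W x) y]
    refine Finset.sum_congr rfl fun x _ => ?_
    rw [← Finset.mul_sum]
    rfl
  have hUY0 : ∀ q, 0 ≤ jointUY₁ W (withInput P' g') q := fun q => by
    rw [jointUY₁_withInput]
    exact Finset.sum_nonneg fun v _ => mul_nonneg (hP'0 _) (fstMarginal_nonneg (hW _).1 _)
  refine ⟨_, _, fun q => P' (e q.1, f q.2), fun a b => g' (e a) (f b),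
    ⟨fun q => hP'0 _, ?_⟩, ?_⟩
  · rw [← hP'1]
    exact (Equiv.prodCongr e f).sum_comp P'
  · rintro R ⟨h1, h2, h3, h4, h5⟩
    have hI₁ : mutualInfo (jointUY₁ W Q) ≤ mutualInfo (jointUY₁ W
        (withInput (fun q => P' (e q.1, f q.2)) fun a b => g' (e a) (f b))) := by
      refine (hUY ▸ mutualInfo_drop_le hUY0).trans_eq ?_
      rw [← mutualInfo_reindex e (Equiv.refl Y₁)]
      congr 1
      funext q
      simp only [jointUY₁_withInput, Equiv.refl_apply]
      exact (f.sum_comp fun v => P' (e q.1, v) * fstMarginal (W (g' (e q.1) v)) q.2).symm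
    have hI₂ : mutualInfo (jointVY₂ W Q) = mutualInfo (jointVY₂ W
        (withInput (fun q => P' (e q.1, f q.2)) fun a b => g' (e a) (f b))) := by
      rw [hVY, ← mutualInfo_reindex f (Equiv.refl Y₂)]
      congr 1
      funext q
      simp only [jointVY₂_withInput, Equiv.refl_apply]
      exact (e.sum_comp fun u => P' (u, f q.1) * sndMarginal (W (g' u (f q.1))) q.2).symm
    have hI : mutualInfo (jointUV Q) = mutualInfo fun q => P' (e q.1, f q.2) := by
      rw [mutualInfo_reindex e f]
      exact (mutualInfo_mul_indep hπ.2).symm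
    refine ⟨h1, h2, h3.trans hI₁, h4.trans_eq hI₂, ?_⟩
    rw [jointUV_withInput, ← hI, ← hI₂]
    linarith

end FunctionalRepresentation

end TSA

end

theorem theorem1 {X Y₁ Y₂ U V : Type*} [Fintype X] [Fintype Y₁] [Fintype Y₂] [Fintype U]
    [Fintype V] (W : X → Y₁ × Y₂ → ℝ) (hW : ∀ x, W x ∈ stdSimplex ℝ (Y₁ × Y₂)) :
    (∀ P ∈ stdSimplex ℝ (U × V), ∀ (g : U → V → X) (I₁ I₂ I : ℝ),
      I₁ = TSA.mutualInfo (TSA.jointUY₁ W (TSA.withInput P g)) →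
      I₂ = TSA.mutualInfo (TSA.jointVY₂ W (TSA.withInput P g)) →
      I = TSA.mutualInfo P →
      (∀ α ∈ Set.Icc (0 : ℝ) 1, ∀ R₁ R₂ : ℝ, R₁ < I₁ - α * I → R₂ < I₂ - (1 - α) * I →
        TSA.EnsembleReliable W P g α R₁ R₂) ∧
      (fun α : ℝ => (I₁ - α * I, I₂ - (1 - α) * I)) '' Set.Icc 0 1 =
        {R : ℝ × ℝ | R.1 ≤ I₁ ∧ R.2 ≤ I₂ ∧ R.1 + R.2 = I₁ + I₂ - I} ∧
      (fun α : ℝ => (I₁ - α * I, I₂ - (1 - α) * I)) '' Set.Icc 0 1 =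
        segment ℝ (I₁, I₂ - I) (I₁ - I, I₂) ∧
      ∀ R ∈ TSA.martonRegion W (TSA.withInput P g), TSA.Achieves W P g R) ∧
    (∀ Q ∈ stdSimplex ℝ (U × V × X), ∀ R ∈ TSA.martonRegion W Q,
      ∃ (k l : ℕ) (P : Fin k × Fin l → ℝ) (g : Fin k → Fin l → X),
        P ∈ stdSimplex ℝ (Fin k × Fin l) ∧ TSA.Achieves W P g R) := by
  refine ⟨fun P hP g I₁ I₂ I hI₁ hI₂ hI => ?_, fun Q hQ R hR => ?_⟩
  · subst hI₁ hI₂ hI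
    exact ⟨fun α hα R₁ R₂ hR₁ hR₂ => TSA.ensembleReliable hW hP g hα.1 hα.2 hR₁ hR₂,
      TSA.image_offset_eq_dominantFace (TSA.mutualInfo_nonneg hP),
      TSA.image_offset_eq_segment _ _ _,
      fun R hR => TSA.achieves_of_mem_martonRegion hW hP g hR⟩
  · obtain ⟨k, l, P, g, hP, hsub⟩ := TSA.exists_martonRegion_subset W hW hQ
    exact ⟨k, l, P, g, hP, TSA.achieves_of_mem_martonRegion hW hP g (hsub hR)⟩
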